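/- Let $n>1$ and let $\Phi:\{0,1\}^n\to\{0,1\}$ be the structure function of a semi-coherent system with $n$ components, i.e. $\Phi$ is monotone with $\Phi(0,\dots,0)=0$ and $\Phi(1,\dots,1)=1$ (a coordinate $1$ means that the component works, and $\Phi(x)=1$ that the system works in state $x$). Its structural signature is $s_k=\overline S_{k-1}-\overline S_k$, $k=1,\dots,n$, where $\overline S_k=\binom{n}{n-k}^{-1}\sum_{x\in\{0,1\}^n,\ |x|=n-k}\Phi(x)$. At time $0$ all components work. The lifetimes of the components, those of the initial components as well as those received at repairs, are i.i.d. exponential with rate $\mu>0$. Fix $r\in\{1,\dots,n\}$; the system operates under the $r$-out-of-$n$:R repair policy: as soon as at least $r$ components are failed or the system is failed, all failed components are instantly repaired (each gets a new lifetime), while working components are left as they are. A repair made with $j$ failed components costs $c_{\rm cmp}(j)\in\mathbb R$, plus $c_{\rm sys}\in\mathbb R$ if the system is failed. Let $T^{(r)}_{rep}$ be the time of the first repair, $T^{(r)}_{fail}\in[0,\infty]$ the time of the first system failure, and $C[0,t]$ the total cost of the repairs made during $[0,t]$. Then: 1. The probability that the first repair is due to a system failure is $$p^{(r)}:=\mathbb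 P\big(T^{(r)}_{rep}=T^{(r)}_{fail}\big)=\sum_{k=1}^r s_k .$$ 2. $C[0,T^{(r)}_{rep}]$ and $T^{(r)}_{rep}$ are integrable, with $$\mathbb E\,C[0,T^{(r)}_{rep}]=\sum_{k=1}^{r}s_k\big(c_{\rm sys}+c_{\rm cmp}(k)\big)+\Big(\sum_{k=r+1}^n s_k\Big)c_{\rm cmp}(r),$$ $$\mathbb E\,T^{(r)}_{rep}=\frac1\mu\left[\sum_{k=1}^r s_k\Big(\sum_{i=n-k+1}^n\frac1i\Big)+\Big(\sum_{k=r+1}^n s_k\Big)\Big(\sum_{i=n-r+1}^n\frac1i\Big)\right].$$ If $p^{(r)}>0$, then $T^{(r)}_{fail}<\infty$ almost surely, $C[0,T^{(r)}_{fail}]$ and $T^{(r)}_{fail}$ are integrable, and $$\mathbb E\,C[0,T^{(r)}_{fail}]=\frac{\mathbb E\,C[0,T^{(r)}_{rep}]}{p^{(r)}},\qquad \mathbb E\,T^{(r)}_{fail}=\frac{\mathbb E\,T^{(r)}_{rep}}{p^{(r)}} .$$ 3. Almost surely there are only finitely many repairs in every bounded time interval, and almost surely $$\lim_{t\to\infty}\frac{C[0,t]}{t}=\mu\,\frac{\sum_{k=1}^{r}s_k\big(c_{\rm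 sys}+c_{\rm cmp}(k)\big)+\big(\sum_{k=r+1}^n s_k\big)c_{\rm cmp}(r)}{\sum_{k=1}^r s_k\big(\sum_{i=n-k+1}^n\frac1i\big)+\big(\sum_{k=r+1}^n s_k\big)\big(\sum_{i=n-r+1}^n\frac1i\big)} .$$ -/

import Mathlib

open MeasureTheory ProbabilityTheory Filter Topology
open scoped ENNReal

namespace RepairPolicy

noncomputable section

/-- A structure function `Φ : {0,1}ⁿ → {0,1}` (`true` is 1, i.e. working) is semi-coherent iff it is
monotone, `Φ(0,…,0) = 0` and `Φ(1,…,1) = 1`. -/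
structure IsSemiCoherent {n : ℕ} (Φ : (Fin n → Bool) → Bool) : Prop where
  monotone : Monotone Φ
  all_failed : Φ (fun _ => false) = false
  all_working : Φ (fun _ => true) = true

/-- The number `|x|` of working components in the state `x`. -/
def numWorking {n : ℕ} (x : Fin n → Bool) : ℕ :=
  (Finset.univ.filter fun i => x i = true).card

/-- The number of failed components in the state `x`. -/
def numFailed {n : ℕ} (x : Fin n → Bool) : ℕ :=
  (Finset.univ.filter fun i => x i = false).card

/-- The proportion, among the states with exactly `k` failed components (`0 ≤ k ≤ n`), of those in
which the system works. -/
def survivalSignature {n : ℕ} (Φ : (Fin n → Bool) → Bool) (k : ℕ) : ℝ :=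
  (1 / (n.choose (n - k) : ℝ)) *
    ∑ x ∈ Finset.univ.filter (fun x : Fin n → Bool => numWorking x = n - k),
      if Φ x = true then (1 : ℝ) else 0

/-- The structural signature `s₁, …, sₙ`. -/
def signature {n : ℕ} (Φ : (Fin n → Bool) → Bool) (k : ℕ) : ℝ :=
  survivalSignature Φ (k - 1) - survivalSignature Φ k

/-- The state at time `t` when component `i` is due to fail at time `d i`. -/
def stateAt {n : ℕ} (d : Fin n → ℝ) (t : ℝ) : Fin n → Bool :=
  fun i => decide (t < d i)

/-- The `r`-out-of-`n`:R policy repairs in the state `x` iff at least `r` components are failed or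
the system is failed. -/
def NeedsRepair {n : ℕ} (Φ : (Fin n → Bool) → Bool) (r : ℕ) (x : Fin n → Bool) : Prop :=
  r ≤ numFailed x ∨ Φ x = false

/-- Evolution of the system under the `r`-out-of-`n`:R policy. The number `ℓ i 0` is the lifetime
of the initial component `i`, and `ℓ i m` for `m ≥ 1` is the new lifetime that component `i`
receives if it is among the components repaired at the `m`-th repair.

The value at `m` is the pair of the time of the `m`-th repair (time `0` for `m = 0`) and the vector
of the times at which the components, right after that repair, are due to fail. The next repair is
made at the first later time at which the policy requires it; it is instantaneous, it renews the
failed components, and the working components are left as they are. -/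
def evolution {n : ℕ} (Φ : (Fin n → Bool) → Bool) (r : ℕ) (ℓ : Fin n → ℕ → ℝ) :
    ℕ → ℝ × (Fin n → ℝ)
  | 0 => (0, fun i => ℓ i 0)
  | m + 1 =>
    let T := (evolution Φ r ℓ m).1
    let d := (evolution Φ r ℓ m).2
    let T' := sInf {t : ℝ | T < t ∧ NeedsRepair Φ r (stateAt d t)}
    (T', fun i => if stateAt d T' i = false then T' + ℓ i (m + 1) else d i)

/-- The time of the `m`-th repair, `m ≥ 1`. -/
def repairTime {n : ℕ} (Φ : (Fin n → Bool) → Bool) (r : ℕ) (ℓ : Fin n → ℕ → ℝ) (m : ℕ) : ℝ :=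
  (evolution Φ r ℓ m).1

/-- The state found by the `(m + 1)`-st repair, just before the components are repaired. -/
def repairState {n : ℕ} (Φ : (Fin n → Bool) → Bool) (r : ℕ) (ℓ : Fin n → ℕ → ℝ) (m : ℕ) :
    Fin n → Bool :=
  stateAt (evolution Φ r ℓ m).2 (repairTime Φ r ℓ (m + 1))

/-- The time of the first repair. -/
def firstRepair {n : ℕ} (Φ : (Fin n → Bool) → Bool) (r : ℕ) (ℓ : Fin n → ℕ → ℝ) : ℝ :=
  repairTime Φ r ℓ 1

/-- The time of the first system failure, `∞` if the system never fails. A failed system is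
repaired at once, so this is the time of the first repair that finds the system failed. -/
def firstFailure {n : ℕ} (Φ : (Fin n → Bool) → Bool) (r : ℕ) (ℓ : Fin n → ℕ → ℝ) : ℝ≥0∞ :=
  ⨅ (m : ℕ) (_ : Φ (repairState Φ r ℓ m) = false), ENNReal.ofReal (repairTime Φ r ℓ (m + 1))

/-- The cost of a repair that is made in the state `x`. -/
def repairCost {n : ℕ} (Φ : (Fin n → Bool) → Bool) (csys : ℝ) (ccmp : ℕ → ℝ)
    (x : Fin n → Bool) : ℝ :=
  ccmp (numFailed x) + if Φ x = false then csys else 0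

/-- The total cost `C[0,t]` of all repairs made during `[0,t]`. -/
def totalCost {n : ℕ} (Φ : (Fin n → Bool) → Bool) (r : ℕ) (csys : ℝ) (ccmp : ℕ → ℝ)
    (ℓ : Fin n → ℕ → ℝ) (t : ℝ≥0∞) : ℝ :=
  ∑' m : ℕ, if ENNReal.ofReal (repairTime Φ r ℓ (m + 1)) ≤ t then
    repairCost Φ csys ccmp (repairState Φ r ℓ m) else 0

end

end RepairPolicy

open RepairPolicy

/-! Call the period between consecutive repairs a cycle. Given which components a cycle finds
failed, and when they failed, all that is known of the others is that they outlive the cycle. By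
memorylessness their residual lifetimes are fresh exponentials, like the lifetimes of the renewed
components. So the residual lifetimes after a repair are again i.i.d. exponential, independent of
the length and final state of the cycle (`map_cycle_renew`). By induction all cycles have the same
law and each is independent of the earlier ones (`exists_measurePreserving_past_residual`). What
remains is the analysis of one cycle and general facts on such sequences.

Final state: lifetimes are almost surely distinct, so a cycle ends at the `k`-th failure for some `k
≤ r`. By exchangeability the set of the first `k` components to fail is uniform, so without repairs
the system survives `k` failures with probability `survivalSignature Φ k` and fails exactly at the
`k`-th with probability `signature Φ k`. This gives the failure probability and the mean cost
(`integral_repairCost`).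

Length: a cycle is longer than `t` iff the state at `t` calls for no repair. Integrating this tail
leads to Beta integrals and to the mean `(1/μ) ∑_{k<r} survivalSignature Φ k / (n-k)`, where
`1/(μ(n-k))` is the mean wait from the `k`-th to the next failure. Summation by parts gives the
stated form (`integral_cycleLength`).

Many cycles: whether a cycle is reached before a system failure is decided by the earlier ones, so
means up to the failure are geometric series (`integral_tsum_until_exit`). The long-run cost follows
from the strong law for lengths and costs and a pathwise renewal-reward argument
(`tendsto_reward_div`). -/

namespace RepairPolicy

/-! ### Repair cycles along a fixed path -/

variable {n : ℕ} {Φ : (Fin n → Bool) → Bool} {r : ℕ}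

/-- The length of a repair cycle that starts when component `i` is due to fail after time `ρ i`. -/
noncomputable def cycleLength (Φ : (Fin n → Bool) → Bool) (r : ℕ) (ρ : Fin n → ℝ) : ℝ :=
  sInf {t : ℝ | 0 < t ∧ NeedsRepair Φ r (stateAt ρ t)}

/-- The state found at the end of a repair cycle. -/
noncomputable def cycleState (Φ : (Fin n → Bool) → Bool) (r : ℕ) (ρ : Fin n → ℝ) : Fin n → Bool :=
  stateAt ρ (cycleLength Φ r ρ)

/-- The residual lifetimes at the start of the next cycle, `ℓ` being the new lifetimes. -/
noncomputable def renew (Φ : (Fin n → Bool) → Bool) (r : ℕ) (ρ ℓ : Fin n → ℝ) : Fin n → ℝ :=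
  fun i => if cycleState Φ r ρ i = false then ℓ i else ρ i - cycleLength Φ r ρ

/-- The residual lifetimes right after the `m`-th repair. -/
noncomputable def residual (Φ : (Fin n → Bool) → Bool) (r : ℕ) (ℓ : Fin n → ℕ → ℝ) :
    ℕ → Fin n → ℝ
  | 0 => fun i => ℓ i 0
  | m + 1 => renew Φ r (residual Φ r ℓ m) fun i => ℓ i (m + 1)

lemma stateAt_add (d : Fin n → ℝ) (T t : ℝ) :
    stateAt d (T + t) = stateAt (fun i => d i - T) t := by
  funext i
  simp only [stateAt, decide_eq_decide]
  constructor <;> intro h <;> linarith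

lemma stateAt_antitone (ρ : Fin n → ℝ) : Antitone (stateAt ρ) := by
  intro s t hst i
  simp only [stateAt]
  by_cases h : t < ρ i
  · simp [h, hst.trans_lt h]
  · simp [h]

lemma numFailed_antitone : Antitone (numFailed (n := n)) := by
  intro x y hxy
  refine Finset.card_le_card fun i hi => ?_
  simp only [Finset.mem_filter, Finset.mem_univ, true_and] at hi ⊢
  have := hxy i
  rw [hi] at this
  exact le_bot_iff.1 this

lemma NeedsRepair.mono (hΦ : IsSemiCoherent Φ) {x y : Fin n → Bool} (hxy : x ≤ y)
    (h : NeedsRepair Φ r y) : NeedsRepair Φ r x := by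
  rcases h with h | h
  · exact Or.inl (h.trans (numFailed_antitone hxy))
  · right
    have := hΦ.monotone hxy
    rw [h] at this
    exact le_bot_iff.1 this

lemma abs_le_sum_abs {ι : Type*} [Fintype ι] (ρ : ι → ℝ) (i : ι) : ρ i ≤ ∑ j, |ρ j| :=
  (le_abs_self _).trans
    (Finset.single_le_sum (f := fun j => |ρ j|) (fun _ _ => abs_nonneg _) (Finset.mem_univ i))

/-- At the chosen time every component has failed, hence so has the system. The infimum defining the
cycle length is therefore a genuine one. -/
lemma repairSet_nonempty (hΦ : IsSemiCoherent Φ) (ρ : Fin n → ℝ) :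
    {t : ℝ | 0 < t ∧ NeedsRepair Φ r (stateAt ρ t)}.Nonempty := by
  refine ⟨1 + ∑ j, |ρ j|, by positivity, Or.inr ?_⟩
  rw [← hΦ.all_failed]
  congr 1
  funext i
  have := abs_le_sum_abs ρ i
  simp only [stateAt, decide_eq_false_iff_not, not_lt]
  linarith

lemma repairSet_bddBelow (ρ : Fin n → ℝ) :
    BddBelow {t : ℝ | 0 < t ∧ NeedsRepair Φ r (stateAt ρ t)} :=
  ⟨0, fun _ ht => ht.1.le⟩

lemma cycleLength_nonneg (ρ : Fin n → ℝ) : 0 ≤ cycleLength Φ r ρ :=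
  Real.sInf_nonneg fun _ ht => ht.1.le

/-- The state is right-continuous in time. -/
lemma exists_stateAt_eq (ρ : Fin n → ℝ) (t : ℝ) :
    ∃ u, t < u ∧ ∀ s, t ≤ s → s < u → stateAt ρ s = stateAt ρ t := by
  have h : ∀ i, ∀ᶠ u in 𝓝[>] t, t < ρ i → u < ρ i := by
    intro i
    by_cases hi : t < ρ i
    · filter_upwards [Ioo_mem_nhdsGT hi] with u hu _ using hu.2
    · exact Eventually.of_forall fun _ h => absurd h hi
  obtain ⟨u, hu, hu'⟩ := ((eventually_all.2 h).and self_mem_nhdsWithin).exists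
  refine ⟨u, hu', fun s hs hsu => ?_⟩
  funext i
  simp only [stateAt, decide_eq_decide]
  exact ⟨hs.trans_lt, fun h => hsu.trans (hu i h)⟩

/-- States decrease in time and the need for repair is inherited by smaller states, so once present
it persists; by right-continuity it is present at the infimum itself. Events about the cycle length
thus become events about the state at a fixed time. -/
lemma lt_cycleLength_iff (hΦ : IsSemiCoherent Φ) (ρ : Fin n → ℝ) {t : ℝ} (ht : 0 ≤ t) :
    t < cycleLength Φ r ρ ↔ ¬ NeedsRepair Φ r (stateAt ρ t) := by
  obtain ⟨u, htu, hu⟩ := exists_stateAt_eq ρ t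
  constructor
  · intro h hN
    have : cycleLength Φ r ρ ≤ t := by
      refine le_of_forall_gt_imp_ge_of_dense fun s hs => csInf_le (repairSet_bddBelow ρ) ?_
      exact ⟨ht.trans_lt hs, hN.mono hΦ (stateAt_antitone ρ hs.le)⟩
    exact absurd h this.not_gt
  · intro hN
    refine htu.trans_le (le_csInf (repairSet_nonempty hΦ ρ) fun s hs => ?_)
    by_contra! hsu
    refine hN ?_
    rcases le_total s t with h | h
    · exact hs.2.mono hΦ (stateAt_antitone ρ h)
    · rw [← hu s h hsu]
      exact hs.2

lemma needsRepair_cycleState (hΦ : IsSemiCoherent Φ) (ρ : Fin n → ℝ) :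
    NeedsRepair Φ r (cycleState Φ r ρ) := by
  by_contra h
  exact lt_irrefl _ ((lt_cycleLength_iff hΦ ρ (cycleLength_nonneg ρ)).2 h)

lemma sInf_needsRepair_eq (hΦ : IsSemiCoherent Φ) (d : Fin n → ℝ) (T : ℝ) :
    sInf {t : ℝ | T < t ∧ NeedsRepair Φ r (stateAt d t)}
      = T + cycleLength Φ r (fun i => d i - T) := by
  have h : {t : ℝ | T < t ∧ NeedsRepair Φ r (stateAt d t)}
      = (fun t => T + t) '' {t : ℝ | 0 < t ∧ NeedsRepair Φ r (stateAt (fun i => d i - T) t)} := by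
    ext t
    simp only [Set.mem_ofPred_eq, Set.mem_image]
    constructor
    · rintro ⟨h1, h2⟩
      refine ⟨t - T, ⟨by linarith, ?_⟩, by ring⟩
      rwa [← stateAt_add, add_sub_cancel]
    · rintro ⟨u, ⟨h1, h2⟩, rfl⟩
      exact ⟨by linarith, by rwa [stateAt_add]⟩
  rw [h, cycleLength]
  exact ((OrderIso.addLeft T).map_csInf' (repairSet_nonempty hΦ _) (repairSet_bddBelow _)).symm

/-- Subtracting the clock time makes every cycle the same function of its residual lifetimes. -/
lemma evolution_snd (hΦ : IsSemiCoherent Φ) (ℓ : Fin n → ℕ → ℝ) (m : ℕ) (i : Fin n) :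
    (evolution Φ r ℓ m).2 i = repairTime Φ r ℓ m + residual Φ r ℓ m i := by
  induction m generalizing i with
  | zero => simp [evolution, repairTime, residual]
  | succ m ih =>
    have hres : (fun i => (evolution Φ r ℓ m).2 i - (evolution Φ r ℓ m).1)
        = residual Φ r ℓ m := by
      funext i
      rw [ih i, repairTime, add_sub_cancel_left]
    have hi := ih i
    rw [repairTime] at hi
    have hT : repairTime Φ r ℓ (m + 1)
        = (evolution Φ r ℓ m).1 + cycleLength Φ r (residual Φ r ℓ m) :=
      (sInf_needsRepair_eq hΦ _ _).trans (by rw [hres])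
    have hs : stateAt (evolution Φ r ℓ m).2 (repairTime Φ r ℓ (m + 1))
        = cycleState Φ r (residual Φ r ℓ m) := by
      rw [hT, stateAt_add, hres, cycleState]
    have he : (evolution Φ r ℓ (m + 1)).2 i
        = if stateAt (evolution Φ r ℓ m).2 (repairTime Φ r ℓ (m + 1)) i = false
          then repairTime Φ r ℓ (m + 1) + ℓ i (m + 1) else (evolution Φ r ℓ m).2 i := rfl
    rw [he, hs, residual, renew]
    split_ifs with h
    · rfl
    · rw [hi, hT]
      ring

lemma residual_eq (hΦ : IsSemiCoherent Φ) (ℓ : Fin n → ℕ → ℝ) (m : ℕ) :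
    (fun i => (evolution Φ r ℓ m).2 i - (evolution Φ r ℓ m).1) = residual Φ r ℓ m := by
  funext i
  rw [evolution_snd hΦ, repairTime, add_sub_cancel_left]

lemma repairTime_zero (ℓ : Fin n → ℕ → ℝ) : repairTime Φ r ℓ 0 = 0 := rfl

lemma repairTime_succ (hΦ : IsSemiCoherent Φ) (ℓ : Fin n → ℕ → ℝ) (m : ℕ) :
    repairTime Φ r ℓ (m + 1) = repairTime Φ r ℓ m + cycleLength Φ r (residual Φ r ℓ m) := by
  rw [← residual_eq hΦ]
  exact sInf_needsRepair_eq hΦ _ _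

lemma repairState_eq (hΦ : IsSemiCoherent Φ) (ℓ : Fin n → ℕ → ℝ) (m : ℕ) :
    repairState Φ r ℓ m = cycleState Φ r (residual Φ r ℓ m) := by
  rw [repairState, repairTime_succ hΦ, repairTime, stateAt_add, residual_eq hΦ, cycleState]

lemma repairTime_eq_sum (hΦ : IsSemiCoherent Φ) (ℓ : Fin n → ℕ → ℝ) (m : ℕ) :
    repairTime Φ r ℓ m = ∑ j ∈ Finset.range m, cycleLength Φ r (residual Φ r ℓ j) := by
  induction m with
  | zero => simp [repairTime_zero]
  | succ m ih => rw [repairTime_succ hΦ, ih, Finset.sum_range_succ]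

lemma not_needsRepair_all_working (hΦ : IsSemiCoherent Φ) (hr1 : 1 ≤ r) :
    ¬ NeedsRepair Φ r (fun _ : Fin n => true) := by
  rintro (h | h)
  · simp [numFailed] at h
    omega
  · simp [hΦ.all_working] at h

lemma cycleLength_pos (hΦ : IsSemiCoherent Φ) (hr1 : 1 ≤ r) {ρ : Fin n → ℝ}
    (hρ : ∀ i, 0 < ρ i) : 0 < cycleLength Φ r ρ := by
  rw [lt_cycleLength_iff hΦ ρ le_rfl]
  have : stateAt ρ 0 = fun _ => true := by
    funext i
    simp [stateAt, hρ i]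
  rw [this]
  exact not_needsRepair_all_working hΦ hr1

/-- The end of a cycle depends only on the lifetimes of the components that it finds failed. -/
lemma cycleLength_congr (hΦ : IsSemiCoherent Φ) {ρ ρ' : Fin n → ℝ}
    (h1 : ∀ i, cycleState Φ r ρ i = false → ρ' i = ρ i)
    (h2 : ∀ i, cycleState Φ r ρ i = true → cycleLength Φ r ρ < ρ' i) :
    cycleLength Φ r ρ' = cycleLength Φ r ρ ∧ cycleState Φ r ρ' = cycleState Φ r ρ := by
  have hst : ∀ t ≤ cycleLength Φ r ρ, stateAt ρ' t = stateAt ρ t := by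
    intro t ht
    funext i
    by_cases hi : cycleState Φ r ρ i = true
    · have h3 := h2 i hi
      simp only [cycleState, stateAt, decide_eq_true_eq] at hi
      simp [stateAt, ht.trans_lt hi, ht.trans_lt h3]
    · simp only [stateAt, h1 i (by simpa using hi)]
  have hlen : cycleLength Φ r ρ' = cycleLength Φ r ρ := by
    refine le_antisymm ?_ ?_
    · by_contra! h
      rw [lt_cycleLength_iff hΦ ρ' (cycleLength_nonneg ρ), hst _ le_rfl] at h
      exact h (needsRepair_cycleState hΦ ρ)
    · by_contra! h
      have h' := h
      rw [lt_cycleLength_iff hΦ ρ (cycleLength_nonneg ρ'), ← hst _ h'.le] at h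
      exact h (needsRepair_cycleState hΦ ρ')
  exact ⟨hlen, by rw [cycleState, hlen, hst _ le_rfl, cycleState]⟩

/-- If the cycle outlasted `c`, its final state would already be present at time `c` and would have
ended it there. -/
lemma cycleLength_le_of_failed_le (hΦ : IsSemiCoherent Φ) {ρ : Fin n → ℝ} {c : ℝ} (hc : 0 ≤ c)
    (h : ∀ i, cycleState Φ r ρ i = false → ρ i ≤ c) : cycleLength Φ r ρ ≤ c := by
  by_contra! hlt
  have hlt' := hlt
  rw [lt_cycleLength_iff hΦ ρ hc] at hlt
  have : stateAt ρ c = cycleState Φ r ρ := by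
    funext i
    by_cases hi : cycleState Φ r ρ i = true
    · rw [hi]
      simp only [cycleState, stateAt, decide_eq_true_eq] at hi ⊢
      exact hlt'.trans hi
    · have hi' : cycleState Φ r ρ i = false := by simpa using hi
      rw [hi']
      simpa [stateAt] using h i hi'
  rw [this] at hlt
  exact hlt (needsRepair_cycleState hΦ ρ)

end RepairPolicy

/-! ### Memorylessness and the renewal property of a repair -/

namespace RepairPolicy

variable {n : ℕ} {Φ : (Fin n → Bool) → Bool} {r : ℕ} {μ : ℝ}

lemma measurable_stateAt {α : Type*} [MeasurableSpace α] {f : α → Fin n → ℝ} {g : α → ℝ}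
    (hf : Measurable f) (hg : Measurable g) : Measurable fun a => stateAt (f a) (g a) := by
  refine measurable_pi_lambda _ fun i => measurable_to_bool ?_
  have : (fun a => stateAt (f a) (g a) i) ⁻¹' {true} = {a | g a < f a i} := by
    ext a
    simp [stateAt]
  rw [this]
  exact measurableSet_lt hg (measurable_pi_iff.1 hf i)

lemma measurable_cycleLength (hΦ : IsSemiCoherent Φ) : Measurable (cycleLength Φ r) := by
  refine measurable_of_Ioi fun t => ?_
  by_cases ht : 0 ≤ t
  · have : cycleLength Φ r ⁻¹' Set.Ioi t
        = (fun ρ => stateAt ρ t) ⁻¹' {x | ¬ NeedsRepair Φ r x} := by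
      ext ρ
      exact lt_cycleLength_iff hΦ ρ ht
    rw [this]
    exact measurable_stateAt measurable_id measurable_const (MeasurableSet.of_discrete)
  · have : cycleLength Φ r ⁻¹' Set.Ioi t = Set.univ := by
      ext ρ
      simpa using (not_le.1 ht).trans_le (cycleLength_nonneg ρ)
    rw [this]
    exact MeasurableSet.univ

lemma measurable_cycleState (hΦ : IsSemiCoherent Φ) : Measurable (cycleState Φ r) :=
  measurable_stateAt measurable_id (measurable_cycleLength hΦ)

lemma measurable_renew (hΦ : IsSemiCoherent Φ) :
    Measurable fun p : (Fin n → ℝ) × (Fin n → ℝ) => renew Φ r p.1 p.2 := by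
  refine measurable_pi_lambda _ fun i => ?_
  have h1 : MeasurableSet {p : (Fin n → ℝ) × (Fin n → ℝ) | cycleState Φ r p.1 i = false} :=
    ((measurable_pi_iff.1 (measurable_cycleState hΦ) i).comp measurable_fst)
      (measurableSet_singleton false)
  refine Measurable.ite h1 ((measurable_pi_apply i).comp measurable_snd) ?_
  exact ((measurable_pi_apply i).comp measurable_fst).sub
    ((measurable_cycleLength hΦ).comp measurable_fst)

/-- The exponential distribution is memoryless. -/
lemma expMeasure_memoryless {s : ℝ} (hs : 0 ≤ s) {C : Set ℝ} (hC : MeasurableSet C) :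
    expMeasure μ {y | s < y ∧ y - s ∈ C} = ENNReal.ofReal (Real.exp (-(μ * s))) * expMeasure μ C := by
  have hm : MeasurableSet {y | s < y ∧ y - s ∈ C} :=
    measurableSet_Ioi.inter ((measurable_id.sub_const s) hC)
  have hpdf : Measurable (exponentialPDF μ) := (measurable_exponentialPDFReal μ).ennreal_ofReal
  have hdef : expMeasure μ = volume.withDensity (exponentialPDF μ) := rfl
  rw [hdef, withDensity_apply _ hm, withDensity_apply _ hC, ← lintegral_indicator hm,
    ← lintegral_indicator hC, ← lintegral_const_mul _ (hpdf.indicator hC),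
    ← lintegral_add_right_eq_self _ s]
  refine lintegral_congr_ae ?_
  -- At `y = 0` the integrands may differ: the strict inequality excludes this point on the left,
  -- while the density on the right need not vanish there.
  have h0 : ∀ᵐ y : ℝ, y ≠ 0 := by simp [ae_iff]
  filter_upwards [h0] with y hy
  rcases lt_or_gt_of_ne hy with h | h
  · have : exponentialPDF μ y = 0 := exponentialPDF_of_neg h
    simp [Set.indicator, this, h.not_gt]
  · by_cases hyC : y ∈ C
    · rw [Set.indicator_of_mem (by simpa using ⟨h, hyC⟩), Set.indicator_of_mem hyC,
        exponentialPDF_of_nonneg (by linarith), exponentialPDF_of_nonneg h.le,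
        ← ENNReal.ofReal_mul (Real.exp_pos _).le]
      congr 1
      rw [mul_add, neg_add, Real.exp_add]
      ring
    · rw [Set.indicator_of_notMem (by simp [hyC]), Set.indicator_of_notMem hyC, mul_zero]

/-- The law of `n` independent exponential lifetimes. -/
noncomputable abbrev lifetimeLaw (n : ℕ) (μ : ℝ) : Measure (Fin n → ℝ) :=
  Measure.pi fun _ => expMeasure μ

/-- Lifetimes that are `a` on the components failed in the state `x`, and larger elsewhere. -/
noncomputable def extendLifetimes (x : Fin n → Bool) (a : {i // x i = false} → ℝ) : Fin n → ℝ :=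
  (MeasurableEquiv.piEquivPiSubtypeProd (fun _ : Fin n => ℝ) fun i => x i = false).symm
    (a, fun _ => 1 + ∑ j, |a j|)

/-- Split the lifetimes into those of the components failed in `x` and the others. If the cycle ends
in `x`, its length depends on the former alone, and the latter only have to exceed it. Fubini and
memorylessness then give each working component the factor `exp (-μ L)`, with `L` the cycle length,
times the law of a new lifetime. -/
lemma lifetimeLaw_cycle_eq (hΦ : IsSemiCoherent Φ) (hμ : 0 < μ) (x : Fin n → Bool) {B : Set ℝ}
    (hB : MeasurableSet B) (C : Fin n → Set ℝ) (hC : ∀ i, MeasurableSet (C i)) :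
    lifetimeLaw n μ {ρ | cycleState Φ r ρ = x ∧ cycleLength Φ r ρ ∈ B ∧
        ∀ i, x i ≠ false → ρ i - cycleLength Φ r ρ ∈ C i}
      = (∫⁻ a, {a | cycleState Φ r (extendLifetimes x a) = x ∧
            cycleLength Φ r (extendLifetimes x a) ∈ B}.indicator
          (fun a => ∏ _i : {i // x i ≠ false},
            ENNReal.ofReal (Real.exp (-(μ * cycleLength Φ r (extendLifetimes x a))))) a
          ∂(Measure.pi fun _ : {i // x i = false} => expMeasure μ))
        * ∏ i : {i // x i ≠ false}, expMeasure μ (C i) := by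
  have := isProbabilityMeasure_expMeasure hμ
  set e := MeasurableEquiv.piEquivPiSubtypeProd (fun _ : Fin n => ℝ) fun i => x i = false with he
  have hmp := (measurePreserving_piEquivPiSubtypeProd (fun _ : Fin n => expMeasure μ)
    fun i => x i = false).symm e
  set S := {ρ : Fin n → ℝ | cycleState Φ r ρ = x ∧ cycleLength Φ r ρ ∈ B ∧
        ∀ i, x i ≠ false → ρ i - cycleLength Φ r ρ ∈ C i} with hS
  have hSm : MeasurableSet S := by
    have h : MeasurableSet {ρ : Fin n → ℝ | ∀ i, x i ≠ false → ρ i - cycleLength Φ r ρ ∈ C i} := by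
      simp only [Set.ofPred_forall]
      refine MeasurableSet.iInter fun i => MeasurableSet.iInter fun _ => ?_
      exact ((measurable_pi_apply i).sub (measurable_cycleLength hΦ)) (hC i)
    exact ((measurable_cycleState hΦ) (measurableSet_singleton x)).inter
      (((measurable_cycleLength hΦ) hB).inter h)
  have hfail : ∀ a b i (h : x i = false), e.symm (a, b) i = a ⟨i, h⟩ := fun a b i h => by
    change (if h : x i = false then a ⟨i, h⟩ else b ⟨i, h⟩) = _
    rw [dif_pos h]
  have hwork : ∀ a b i (h : x i ≠ false), e.symm (a, b) i = b ⟨i, h⟩ := fun a b i h => by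
    change (if h : x i = false then a ⟨i, h⟩ else b ⟨i, h⟩) = _
    rw [dif_neg h]
  have key : ∀ a b, e.symm (a, b) ∈ S ↔ (cycleState Φ r (extendLifetimes x a) = x ∧
      cycleLength Φ r (extendLifetimes x a) ∈ B) ∧ ∀ i : {i // x i ≠ false},
        cycleLength Φ r (extendLifetimes x a) < b i ∧
          b i - cycleLength Φ r (extendLifetimes x a) ∈ C i := by
    intro a b
    constructor
    · rintro ⟨h1, h2, h3⟩
      -- All components failed in `x` have failed by this time, so the padding `1 + ∑ j, |a j|` in
      -- `extendLifetimes` outlives the cycle.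
      have hle : cycleLength Φ r (e.symm (a, b)) ≤ ∑ j, |a j| := by
        refine cycleLength_le_of_failed_le hΦ (by positivity) fun i hi => ?_
        rw [h1] at hi
        rw [hfail a b i hi]
        exact abs_le_sum_abs a _
      obtain ⟨h4, h5⟩ := cycleLength_congr hΦ (ρ := e.symm (a, b)) (ρ' := extendLifetimes x a)
        (fun i hi => by
          rw [h1] at hi
          rw [extendLifetimes, hfail _ _ i hi, hfail _ _ i hi])
        (fun i hi => by
          rw [h1] at hi
          rw [extendLifetimes, hwork _ _ i (by simp [hi])]
          linarith)
      rw [h4, h5]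
      refine ⟨⟨h1, h2⟩, fun i => ?_⟩
      have h6 := congrFun h1 i
      have h7 : x i = true := by simpa using i.2
      rw [h7] at h6
      simp only [cycleState, stateAt, decide_eq_true_eq] at h6
      have h8 := h3 i i.2
      rw [hwork _ _ _ i.2] at h6 h8
      exact ⟨h6, h8⟩
    · rintro ⟨⟨h1, h2⟩, h3⟩
      obtain ⟨h4, h5⟩ := cycleLength_congr hΦ (ρ' := e.symm (a, b)) (ρ := extendLifetimes x a)
        (fun i hi => by
          rw [h1] at hi
          rw [extendLifetimes, hfail _ _ i hi, hfail _ _ i hi])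
        (fun i hi => by
          rw [h1] at hi
          rw [hwork _ _ i (by simp [hi])]
          exact (h3 ⟨i, by simp [hi]⟩).1)
      refine ⟨h5.trans h1, h4 ▸ h2, fun i hi => ?_⟩
      rw [h4, hwork _ _ _ hi]
      exact (h3 ⟨i, hi⟩).2
  rw [← hmp.measure_preimage hSm.nullMeasurableSet,
    Measure.prod_apply (e.symm.measurable hSm)]
  have hmext : Measurable (extendLifetimes x) := by
    refine e.symm.measurable.comp (measurable_id.prodMk ?_)
    refine measurable_pi_lambda _ fun _ => ?_
    fun_prop
  have hmL := (measurable_cycleLength (r := r) hΦ).comp hmext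
  have hms := (measurable_cycleState (r := r) hΦ).comp hmext
  have hmset : MeasurableSet {a | cycleState Φ r (extendLifetimes x a) = x ∧
            cycleLength Φ r (extendLifetimes x a) ∈ B} :=
    (hms (measurableSet_singleton x)).inter (hmL hB)
  rw [← lintegral_mul_const]
  · refine lintegral_congr fun a => ?_
    by_cases ha : cycleState Φ r (extendLifetimes x a) = x ∧
            cycleLength Φ r (extendLifetimes x a) ∈ B
    · have hset : Prod.mk a ⁻¹' (e.symm ⁻¹' S) = Set.univ.pi fun i : {i // x i ≠ false} =>
          {y | cycleLength Φ r (extendLifetimes x a) < y ∧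
            y - cycleLength Φ r (extendLifetimes x a) ∈ C i} := by
        ext b
        simp only [Set.mem_preimage, key, Set.mem_univ_pi, Set.mem_ofPred_eq]
        exact and_iff_right ha
      rw [hset, Measure.pi_pi, Set.indicator_of_mem (by exact ha), ← Finset.prod_mul_distrib]
      exact Finset.prod_congr rfl fun i _ =>
        expMeasure_memoryless (cycleLength_nonneg _) (hC i)
    · have hset : Prod.mk a ⁻¹' (e.symm ⁻¹' S) = ∅ := by
        ext b
        simp only [Set.mem_preimage, key, Set.mem_empty_iff_false, iff_false]
        exact fun h => ha h.1
      rw [hset, Set.indicator_of_notMem (by exact ha), measure_empty, zero_mul]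
  · refine Measurable.indicator ?_ hmset
    refine Finset.measurable_prod _ fun i _ => ?_
    exact (Real.measurable_exp.comp ((hmL.const_mul μ).neg)).ennreal_ofReal

/-- Taking every `C i` to be the whole line identifies the integral in `lifetimeLaw_cycle_eq`. -/
lemma lifetimeLaw_cycle_inter (hΦ : IsSemiCoherent Φ) (hμ : 0 < μ) (x : Fin n → Bool) {B : Set ℝ}
    (hB : MeasurableSet B) (C : Fin n → Set ℝ) (hC : ∀ i, MeasurableSet (C i)) :
    lifetimeLaw n μ {ρ | cycleState Φ r ρ = x ∧ cycleLength Φ r ρ ∈ B ∧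
        ∀ i, x i ≠ false → ρ i - cycleLength Φ r ρ ∈ C i}
      = lifetimeLaw n μ {ρ | cycleState Φ r ρ = x ∧ cycleLength Φ r ρ ∈ B}
        * ∏ i : {i // x i ≠ false}, expMeasure μ (C i) := by
  have := isProbabilityMeasure_expMeasure hμ
  have h := lifetimeLaw_cycle_eq (r := r) hΦ hμ x hB (fun _ => Set.univ) fun _ => MeasurableSet.univ
  simp only [Set.mem_univ, implies_true, and_true, measure_univ, Finset.prod_const_one,
    mul_one] at h
  rw [lifetimeLaw_cycle_eq hΦ hμ x hB C hC, h]

/-- With the final state fixed, failed components read only the new lifetimes and working ones only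
the old. The event is a product set, and the factors `expMeasure μ (C i)` from the two sides
recombine. -/
lemma lifetimeLaw_prod_renew (hΦ : IsSemiCoherent Φ) (hμ : 0 < μ) (x : Fin n → Bool) {B : Set ℝ}
    (hB : MeasurableSet B) (C : Fin n → Set ℝ) (hC : ∀ i, MeasurableSet (C i)) :
    ((lifetimeLaw n μ).prod (lifetimeLaw n μ)) {p | cycleState Φ r p.1 = x ∧
        cycleLength Φ r p.1 ∈ B ∧ renew Φ r p.1 p.2 ∈ Set.univ.pi C}
      = lifetimeLaw n μ {ρ | cycleState Φ r ρ = x ∧ cycleLength Φ r ρ ∈ B}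
        * lifetimeLaw n μ (Set.univ.pi C) := by
  have := isProbabilityMeasure_expMeasure hμ
  have hset : {p : (Fin n → ℝ) × (Fin n → ℝ) | cycleState Φ r p.1 = x ∧
        cycleLength Φ r p.1 ∈ B ∧ renew Φ r p.1 p.2 ∈ Set.univ.pi C}
      = {ρ | cycleState Φ r ρ = x ∧ cycleLength Φ r ρ ∈ B ∧
          ∀ i, x i ≠ false → ρ i - cycleLength Φ r ρ ∈ C i} ×ˢ
        Set.univ.pi (fun i => if x i = false then C i else Set.univ) := by
    ext ⟨ρ, ℓ⟩
    simp only [Set.mem_ofPred_eq, Set.mem_prod, Set.mem_univ_pi, and_assoc]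
    refine and_congr_right fun h1 => and_congr_right fun h2 => ?_
    rw [← forall_and]
    refine forall_congr' fun i => ?_
    rw [renew, h1]
    by_cases hi : x i = false <;> simp [hi]
  rw [hset, Measure.prod_prod, lifetimeLaw_cycle_inter hΦ hμ x hB C hC, Measure.pi_pi,
    Measure.pi_pi, mul_assoc]
  congr 1
  rw [← Fintype.prod_subtype_mul_prod_subtype (fun i => x i = false) fun i => expMeasure μ (C i),
    mul_comm]
  congr 1
  rw [← Fintype.prod_subtype_mul_prod_subtype (fun i => x i = false)]
  have h1 : ∏ i : {i // ¬ x i = false},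
      expMeasure μ (if x i = false then C i else Set.univ) = 1 :=
    Finset.prod_eq_one fun i _ => by rw [if_neg i.2, measure_univ]
  rw [h1, mul_one]
  exact Finset.prod_congr rfl fun i _ => by rw [if_pos i.2]

/-- The lifetimes after a repair are independent of the cycle that precedes it, and distributed
like new ones. -/
theorem map_cycle_renew (hΦ : IsSemiCoherent Φ) (hμ : 0 < μ) :
    ((lifetimeLaw n μ).prod (lifetimeLaw n μ)).map
        (fun p => ((cycleLength Φ r p.1, cycleState Φ r p.1), renew Φ r p.1 p.2))
      = ((lifetimeLaw n μ).map fun ρ => (cycleLength Φ r ρ, cycleState Φ r ρ)).prod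
          (lifetimeLaw n μ) := by
  have := isProbabilityMeasure_expMeasure hμ
  have hcyc : Measurable fun ρ => (cycleLength Φ r ρ, cycleState Φ r ρ) :=
    (measurable_cycleLength hΦ).prodMk (measurable_cycleState hΦ)
  have hmap : Measurable fun p : (Fin n → ℝ) × (Fin n → ℝ) =>
      ((cycleLength Φ r p.1, cycleState Φ r p.1), renew Φ r p.1 p.2) :=
    (hcyc.comp measurable_fst).prodMk (measurable_renew hΦ)
  have : IsProbabilityMeasure
      ((lifetimeLaw n μ).map fun ρ => (cycleLength Φ r ρ, cycleState Φ r ρ)) :=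
    Measure.isProbabilityMeasure_map hcyc.aemeasurable
  symm
  -- It suffices to compare both measures on products of a measurable set with a box.
  refine Measure.prod_eq_generateFrom MeasurableSpace.generateFrom_measurableSet
    (generateFrom_pi (ι := Fin n) (α := fun _ => ℝ)) MeasurableSpace.isPiSystem_measurableSet
    isPiSystem_pi (Measure.toFiniteSpanningSetsIn _)
    ⟨fun _ => Set.univ, fun _ => ⟨fun _ => Set.univ, fun _ _ => by simp, by simp⟩,
      fun _ => measure_lt_top _ _, Set.iUnion_const _⟩ ?_
  rintro s hs _ ⟨C, hC, rfl⟩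
  replace hs : MeasurableSet s := hs
  replace hC : ∀ i, MeasurableSet (C i) := fun i => hC i (Set.mem_univ i)
  have hpi : MeasurableSet (Set.univ.pi C) := MeasurableSet.univ_pi hC
  rw [Measure.map_apply hmap (hs.prod hpi), Measure.map_apply hcyc hs]
  have hms := measurable_cycleState (r := r) hΦ
  -- Both sides are split over the finitely many final states `x`; for each, only the section of `s`
  -- at `x` matters.
  have hsum1 := sum_measure_preimage_singleton (μ := (lifetimeLaw n μ).restrict
    ((fun ρ => (cycleLength Φ r ρ, cycleState Φ r ρ)) ⁻¹' s)) Finset.univ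
    fun x _ => hms (measurableSet_singleton x)
  have hsum2 := sum_measure_preimage_singleton
    (μ := ((lifetimeLaw n μ).prod (lifetimeLaw n μ)).restrict
    ((fun p => ((cycleLength Φ r p.1, cycleState Φ r p.1), renew Φ r p.1 p.2)) ⁻¹'
      (s ×ˢ Set.univ.pi C))) Finset.univ
    fun x _ => (hms.comp measurable_fst) (measurableSet_singleton x)
  simp only [Finset.coe_univ, Set.preimage_univ, Measure.restrict_apply_univ] at hsum1 hsum2
  rw [← hsum1, ← hsum2, Finset.sum_mul]
  refine Finset.sum_congr rfl fun x _ => ?_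
  rw [Measure.restrict_apply ((hms.comp measurable_fst) (measurableSet_singleton x)),
    Measure.restrict_apply (hms (measurableSet_singleton x))]
  have hB : MeasurableSet ((fun t => (t, x)) ⁻¹' s) := (measurable_id.prodMk measurable_const) hs
  have h := lifetimeLaw_prod_renew (r := r) hΦ hμ x hB C hC
  refine (congrArg _ ?_).trans (h.trans (congrArg (· * _) (congrArg _ ?_)))
  · ext p
    simp only [Set.mem_inter_iff, Set.mem_preimage, Function.comp_apply, Set.mem_singleton_iff,
      Set.mem_prod, Set.mem_ofPred_eq]
    exact and_congr_right fun hx => by rw [hx]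
  · ext p
    simp only [Set.mem_inter_iff, Set.mem_preimage, Set.mem_singleton_iff, Set.mem_ofPred_eq]
    exact and_congr_right fun hx => by rw [hx]

end RepairPolicy

/-! ### The mean length of a cycle -/

namespace RepairPolicy

variable {n : ℕ} {Φ : (Fin n → Bool) → Bool} {r : ℕ} {μ : ℝ}

/-- With `u = exp (-μ t)` this is a Beta integral. The induction rests on `(1-u)^(k+1) u^(j+1) =
(1-u)^k u^(j+1) - (1-u)^k u^(j+2)`. -/
lemma integral_exp_pow (hμ : 0 < μ) (k j : ℕ) :
    IntegrableOn (fun t : ℝ => (1 - Real.exp (-(μ * t))) ^ k * Real.exp (-(μ * t)) ^ (j + 1))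
        (Set.Ioi 0) ∧
      ∫ t in Set.Ioi (0 : ℝ), (1 - Real.exp (-(μ * t))) ^ k * Real.exp (-(μ * t)) ^ (j + 1)
        = (1 / μ) * (k.factorial * j.factorial / (k + j + 1).factorial) := by
  induction k generalizing j with
  | zero =>
    have hneg : -(μ * (j + 1)) < 0 := by
      have : 0 < μ * (j + 1) := by positivity
      linarith
    have h : (fun t : ℝ => (1 - Real.exp (-(μ * t))) ^ 0 * Real.exp (-(μ * t)) ^ (j + 1))
        = fun t => Real.exp (-(μ * (j + 1)) * t) := by
      funext t
      rw [pow_zero, one_mul, ← Real.exp_nat_mul]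
      congr 1
      push_cast
      ring
    rw [h]
    refine ⟨integrableOn_exp_mul_Ioi hneg 0, ?_⟩
    rw [integral_exp_mul_Ioi hneg]
    have : ((j.factorial : ℕ) : ℝ) ≠ 0 := by positivity
    simp only [mul_zero, Real.exp_zero, Nat.factorial_zero, zero_add, Nat.factorial_succ]
    push_cast
    field_simp
  | succ k ih =>
    have h : (fun t : ℝ => (1 - Real.exp (-(μ * t))) ^ (k + 1) * Real.exp (-(μ * t)) ^ (j + 1))
        = fun t => (1 - Real.exp (-(μ * t))) ^ k * Real.exp (-(μ * t)) ^ (j + 1)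
          - (1 - Real.exp (-(μ * t))) ^ k * Real.exp (-(μ * t)) ^ (j + 1 + 1) := by
      funext t
      ring
    rw [h]
    refine ⟨(ih j).1.sub (ih (j + 1)).1, ?_⟩
    rw [integral_sub (ih j).1 (ih (j + 1)).1, (ih j).2, (ih (j + 1)).2,
      show k + (j + 1) + 1 = (k + j + 1) + 1 by ring, show k + 1 + j + 1 = (k + j + 1) + 1 by ring,
      Nat.factorial_succ (k + j + 1), Nat.factorial_succ j, Nat.factorial_succ k]
    have : (((k + j + 1).factorial : ℕ) : ℝ) ≠ 0 := by positivity
    push_cast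
    field_simp
    ring

lemma expMeasure_real_Iic (hμ : 0 < μ) {t : ℝ} (ht : 0 ≤ t) :
    (expMeasure μ).real (Set.Iic t) = 1 - Real.exp (-(μ * t)) := by
  have := isProbabilityMeasure_expMeasure hμ
  rw [← cdf_eq_real, cdf_expMeasure_eq hμ, if_pos ht]

lemma expMeasure_real_Ioi (hμ : 0 < μ) {t : ℝ} (ht : 0 ≤ t) :
    (expMeasure μ).real (Set.Ioi t) = Real.exp (-(μ * t)) := by
  have := isProbabilityMeasure_expMeasure hμ
  rw [← Set.compl_Iic, probReal_compl_eq_one_sub measurableSet_Iic, expMeasure_real_Iic hμ ht]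
  ring

lemma numWorking_add_numFailed (x : Fin n → Bool) : numWorking x + numFailed x = n := by
  have h := Finset.card_filter_add_card_filter_not (s := (Finset.univ : Finset (Fin n)))
    (fun i => x i = true)
  simpa [numWorking, numFailed] using h

lemma lifetimeLaw_real_stateAt (hμ : 0 < μ) {t : ℝ} (ht : 0 ≤ t) (x : Fin n → Bool) :
    (lifetimeLaw n μ).real {ρ | stateAt ρ t = x}
      = (1 - Real.exp (-(μ * t))) ^ numFailed x * Real.exp (-(μ * t)) ^ (n - numFailed x) := by
  have := isProbabilityMeasure_expMeasure hμ
  have hset : {ρ : Fin n → ℝ | stateAt ρ t = x}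
      = Set.univ.pi fun i => if x i = false then Set.Iic t else Set.Ioi t := by
    ext ρ
    simp only [Set.mem_ofPred_eq, Set.mem_univ_pi, funext_iff, stateAt]
    refine forall_congr' fun i => ?_
    cases x i <;> simp
  rw [hset, measureReal_def, Measure.pi_pi, ENNReal.toReal_prod]
  have h : ∀ i, (expMeasure μ (if x i = false then Set.Iic t else Set.Ioi t)).toReal
      = if x i = false then 1 - Real.exp (-(μ * t)) else Real.exp (-(μ * t)) := by
    intro i
    split_ifs
    · exact expMeasure_real_Iic hμ ht
    · exact expMeasure_real_Ioi hμ ht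
  simp only [h]
  rw [Finset.prod_ite, Finset.prod_const, Finset.prod_const]
  congr 2
  have hw := numWorking_add_numFailed x
  simp only [numWorking] at hw
  simp only [Bool.not_eq_false]
  omega

lemma survivalSignature_eq {k : ℕ} (hk : k ≤ n) :
    survivalSignature Φ k = (1 / (n.choose k : ℝ)) *
      ∑ x ∈ Finset.univ.filter (fun x : Fin n → Bool => numFailed x = k),
        if Φ x = true then (1 : ℝ) else 0 := by
  rw [survivalSignature, Nat.choose_symm hk]
  congr 2
  ext x
  have := numWorking_add_numFailed x
  simp only [Finset.mem_filter, Finset.mem_univ, true_and]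
  omega

/-- For `k` failed components the summand is `1/μ` times the inverse of `(n.choose k) * (n - k)`;
grouping by `k` produces the survival signature. -/
lemma sum_states_eq (hrn : r ≤ n) :
    ∑ x ∈ Finset.univ.filter (fun x => numFailed x < r ∧ Φ x = true),
        (1 / μ) * ((numFailed x).factorial * (n - numFailed x - 1).factorial / n.factorial : ℝ)
      = (1 / μ) * ∑ k ∈ Finset.range r, survivalSignature Φ k * (1 / ((n - k : ℕ) : ℝ)) := by
  rw [← Finset.mul_sum]
  congr 1
  rw [← Finset.sum_fiberwise_of_maps_to (t := Finset.range r) (g := numFailed)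
    (fun x hx => by simpa using (Finset.mem_filter.1 hx).2.1)]
  refine Finset.sum_congr rfl fun k hk => ?_
  have hk' : k < n := (Finset.mem_range.1 hk).trans_le hrn
  rw [survivalSignature_eq hk'.le, ← Finset.sum_filter, Finset.filter_filter,
    Finset.filter_filter, mul_right_comm, Finset.mul_sum]
  have hset : (Finset.univ.filter fun x : Fin n → Bool =>
      (numFailed x < r ∧ Φ x = true) ∧ numFailed x = k)
      = Finset.univ.filter fun x => numFailed x = k ∧ Φ x = true := by
    ext x
    have := Finset.mem_range.1 hk
    simp only [Finset.mem_filter, Finset.mem_univ, true_and]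
    constructor
    · rintro ⟨⟨_, h⟩, h'⟩
      exact ⟨h', h⟩
    · rintro ⟨h, h'⟩
      exact ⟨⟨h ▸ this, h'⟩, h⟩
  rw [hset]
  refine Finset.sum_congr rfl fun x hx => ?_
  rw [(Finset.mem_filter.1 hx).2.1, Nat.cast_choose ℝ hk'.le]
  obtain ⟨j, hj⟩ : ∃ j, n - k = j + 1 := ⟨n - k - 1, by omega⟩
  rw [hj, Nat.add_sub_cancel, Nat.factorial_succ]
  have h1 : ((k.factorial : ℕ) : ℝ) ≠ 0 := by positivity
  have h2 : ((j.factorial : ℕ) : ℝ) ≠ 0 := by positivity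
  have h3 : ((n.factorial : ℕ) : ℝ) ≠ 0 := by positivity
  push_cast
  field_simp

lemma not_needsRepair_iff (x : Fin n → Bool) :
    ¬ NeedsRepair Φ r x ↔ numFailed x < r ∧ Φ x = true := by
  simp [NeedsRepair]

/-- The mean is the integral of the tail, which is the sum of the probabilities of the states that
need no repair. The extended-valued form also yields integrability. -/
lemma lintegral_cycleLength (hΦ : IsSemiCoherent Φ) (hμ : 0 < μ) (hrn : r ≤ n) :
    ∫⁻ ρ, ENNReal.ofReal (cycleLength Φ r ρ) ∂(lifetimeLaw n μ)
      = ENNReal.ofReal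
        ((1 / μ) * ∑ k ∈ Finset.range r, survivalSignature Φ k * (1 / ((n - k : ℕ) : ℝ))) := by
  have := isProbabilityMeasure_expMeasure hμ
  rw [lintegral_eq_lintegral_meas_lt _ (Eventually.of_forall cycleLength_nonneg)
    (measurable_cycleLength hΦ).aemeasurable, ← sum_states_eq hrn]
  -- Some component still works, as fewer than `r ≤ n` have failed; this positive power of `exp (-μ
  -- t)` makes the integral converge.
  have hpow : ∀ x ∈ Finset.univ.filter (fun x : Fin n → Bool => numFailed x < r ∧ Φ x = true),
      n - numFailed x = (n - numFailed x - 1) + 1 := fun x hx => by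
    have := (Finset.mem_filter.1 hx).2.1
    omega
  have hmeas : ∀ t ∈ Set.Ioi (0 : ℝ), lifetimeLaw n μ {ρ | t < cycleLength Φ r ρ}
      = ENNReal.ofReal (∑ x ∈ Finset.univ.filter (fun x => numFailed x < r ∧ Φ x = true),
          (1 - Real.exp (-(μ * t))) ^ numFailed x
            * Real.exp (-(μ * t)) ^ (n - numFailed x - 1 + 1)) := by
    intro t ht
    replace ht : 0 ≤ t := le_of_lt ht
    have hset : {ρ : Fin n → ℝ | t < cycleLength Φ r ρ} = (fun ρ => stateAt ρ t) ⁻¹'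
        (Finset.univ.filter (fun x => numFailed x < r ∧ Φ x = true) : Finset _) := by
      ext ρ
      simp [lt_cycleLength_iff hΦ ρ ht, not_needsRepair_iff]
    have hms : Measurable fun ρ : Fin n → ℝ => stateAt ρ t :=
      measurable_stateAt measurable_id measurable_const
    rw [hset, ← sum_measure_preimage_singleton _ fun x _ => hms (measurableSet_singleton x),
      ENNReal.ofReal_sum_of_nonneg]
    · refine Finset.sum_congr rfl fun x hx => ?_
      rw [← hpow x hx, ← lifetimeLaw_real_stateAt hμ ht x, ofReal_measureReal]
      rfl
    · intro x _
      have : Real.exp (-(μ * t)) ≤ 1 := Real.exp_le_one_iff.2 (by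
        have := mul_nonneg hμ.le ht
        linarith)
      exact mul_nonneg (pow_nonneg (by linarith) _) (pow_nonneg (Real.exp_pos _).le _)
  rw [setLIntegral_congr_fun measurableSet_Ioi hmeas,
    ← ofReal_integral_eq_lintegral_ofReal]
  · congr 1
    rw [integral_finsetSum _ fun x _ => (integral_exp_pow hμ _ _).1]
    refine Finset.sum_congr rfl fun x hx => ?_
    rw [(integral_exp_pow hμ _ _).2]
    have := (Finset.mem_filter.1 hx).2.1
    rw [show numFailed x + (n - numFailed x - 1) + 1 = n by omega]
  · exact integrable_finsetSum _ fun x _ => (integral_exp_pow hμ _ _).1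
  · filter_upwards [ae_restrict_mem measurableSet_Ioi] with t ht
    have hexp : Real.exp (-(μ * t)) ≤ 1 := Real.exp_le_one_iff.2 (by
      have := mul_nonneg hμ.le (le_of_lt ht)
      linarith)
    exact Finset.sum_nonneg fun x _ =>
      mul_nonneg (pow_nonneg (by linarith) _) (pow_nonneg (Real.exp_pos _).le _)

lemma survivalSignature_nonneg (k : ℕ) : 0 ≤ survivalSignature Φ k := by
  refine mul_nonneg (by positivity) (Finset.sum_nonneg fun x _ => ?_)
  split_ifs <;> norm_num

lemma integrable_cycleLength (hΦ : IsSemiCoherent Φ) (hμ : 0 < μ) (hrn : r ≤ n) :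
    Integrable (cycleLength Φ r) (lifetimeLaw n μ) := by
  rw [← lintegral_ofReal_ne_top_iff_integrable
    (measurable_cycleLength hΦ).aestronglyMeasurable
    (Eventually.of_forall cycleLength_nonneg), lintegral_cycleLength hΦ hμ hrn]
  exact ENNReal.ofReal_ne_top

lemma integral_cycleLength_eq_sum (hΦ : IsSemiCoherent Φ) (hμ : 0 < μ) (hrn : r ≤ n) :
    ∫ ρ, cycleLength Φ r ρ ∂(lifetimeLaw n μ)
      = (1 / μ) * ∑ k ∈ Finset.range r, survivalSignature Φ k * (1 / ((n - k : ℕ) : ℝ)) := by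
  rw [integral_eq_lintegral_of_nonneg_ae (Eventually.of_forall cycleLength_nonneg)
    (measurable_cycleLength hΦ).aestronglyMeasurable, lintegral_cycleLength hΦ hμ hrn,
    ENNReal.toReal_ofReal]
  refine mul_nonneg (by positivity) (Finset.sum_nonneg fun k _ => ?_)
  exact mul_nonneg (survivalSignature_nonneg k) (by positivity)

lemma sum_signature_Icc {a b : ℕ} (hab : a ≤ b) :
    ∑ k ∈ Finset.Icc (a + 1) b, signature Φ k = survivalSignature Φ a - survivalSignature Φ b := by
  induction b, hab using Nat.le_induction with
  | base => simp
  | succ b hab ih =>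
    rw [Finset.sum_Icc_succ_top (by omega), ih, signature, Nat.add_sub_cancel]
    ring

lemma survivalSignature_all_failed (hΦ : IsSemiCoherent Φ) : survivalSignature Φ n = 0 := by
  rw [survivalSignature_eq le_rfl, Finset.sum_eq_zero, mul_zero]
  intro x hx
  have hx' := (Finset.mem_filter.1 hx).2
  have : x = fun _ => false := by
    funext i
    have h : Finset.univ.filter (fun i => x i = false) = Finset.univ :=
      Finset.eq_univ_of_card _ (by simpa [numFailed] using hx')
    have := Finset.mem_univ i
    rw [← h] at this
    exact (Finset.mem_filter.1 this).2
  rw [this, hΦ.all_failed]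
  simp

lemma sum_signature_tail (hΦ : IsSemiCoherent Φ) (hrn : r ≤ n) :
    ∑ k ∈ Finset.Icc (r + 1) n, signature Φ k = survivalSignature Φ r := by
  rw [sum_signature_Icc hrn, survivalSignature_all_failed hΦ, sub_zero]

/-- Summation by parts: from `r` to `r + 1` the harmonic sum grows by `1 / (n - r)`. -/
lemma sum_signature_mul_harmonic (hrn : r ≤ n) :
    ∑ k ∈ Finset.Icc 1 r, signature Φ k * ∑ i ∈ Finset.Icc (n - k + 1) n, 1 / (i : ℝ)
        + survivalSignature Φ r * ∑ i ∈ Finset.Icc (n - r + 1) n, 1 / (i : ℝ)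
      = ∑ k ∈ Finset.range r, survivalSignature Φ k * (1 / ((n - k : ℕ) : ℝ)) := by
  induction r with
  | zero => simp
  | succ r ih =>
    have h : ∑ i ∈ Finset.Icc (n - (r + 1) + 1) n, 1 / (i : ℝ)
        = 1 / ((n - r : ℕ) : ℝ) + ∑ i ∈ Finset.Icc (n - r + 1) n, 1 / (i : ℝ) := by
      rw [show n - (r + 1) + 1 = n - r by omega, ← Finset.add_sum_Ioc_eq_sum_Icc (by omega),
        Finset.Icc_add_one_left_eq_Ioc]
    rw [Finset.sum_Icc_succ_top (by omega), Finset.sum_range_succ, ← ih (by omega), signature,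
      Nat.add_sub_cancel, h]
    ring

theorem integral_cycleLength (hΦ : IsSemiCoherent Φ) (hμ : 0 < μ) (hrn : r ≤ n) :
    ∫ ρ, cycleLength Φ r ρ ∂(lifetimeLaw n μ) = (1 / μ) *
      (∑ k ∈ Finset.Icc 1 r, signature Φ k * ∑ i ∈ Finset.Icc (n - k + 1) n, 1 / (i : ℝ)
        + (∑ k ∈ Finset.Icc (r + 1) n, signature Φ k)
          * ∑ i ∈ Finset.Icc (n - r + 1) n, 1 / (i : ℝ)) := by
  rw [integral_cycleLength_eq_sum hΦ hμ hrn, sum_signature_tail hΦ hrn,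
    sum_signature_mul_harmonic hrn]

end RepairPolicy

/-! ### The order of the failures, and the state and cost at the end of a cycle -/

namespace RepairPolicy

variable {n : ℕ} {Φ : (Fin n → Bool) → Bool} {r : ℕ} {μ : ℝ}

lemma expMeasure_singleton (x : ℝ) : expMeasure μ {x} = 0 :=
  withDensity_absolutelyContinuous volume (gammaPDF 1 μ) (measure_singleton x)

lemma ae_lifetimeLaw_pos (hμ : 0 < μ) : ∀ᵐ ρ ∂(lifetimeLaw n μ), ∀ i, 0 < ρ i := by
  have := isProbabilityMeasure_expMeasure hμ
  refine ae_all_iff.2 fun i => ?_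
  have h : ∀ᵐ y ∂(expMeasure μ), 0 < y := by
    have h0 := expMeasure_real_Iic hμ le_rfl
    rw [mul_zero, neg_zero, Real.exp_zero, sub_self, measureReal_eq_zero_iff] at h0
    rw [ae_iff]
    convert h0 using 2
    ext y
    simp
  exact (measurePreserving_eval (fun _ : Fin n => expMeasure μ) i).quasiMeasurePreserving.ae h

/-- The exponential law has no atoms, so by Fubini each tie is a null event. -/
lemma ae_lifetimeLaw_injective (hμ : 0 < μ) :
    ∀ᵐ ρ ∂(lifetimeLaw n μ), Function.Injective ρ := by
  have := isProbabilityMeasure_expMeasure hμ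
  have h : ∀ i j : Fin n, i ≠ j → ∀ᵐ ρ ∂(lifetimeLaw n μ), ρ i ≠ ρ j := by
    intro i j hij
    have hind : iIndepFun (fun (i : Fin n) (ρ : Fin n → ℝ) => ρ i) (lifetimeLaw n μ) :=
      iIndepFun_pi (X := fun _ => id) (μ := fun _ : Fin n => expMeasure μ) fun _ => aemeasurable_id
    have hpair := (indepFun_iff_map_prod_eq_prod_map_map (measurable_pi_apply i).aemeasurable
      (measurable_pi_apply j).aemeasurable).1 (hind.indepFun hij)
    have hi := (measurePreserving_eval (fun _ : Fin n => expMeasure μ) i).map_eq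
    have hj := (measurePreserving_eval (fun _ : Fin n => expMeasure μ) j).map_eq
    have hi' : (lifetimeLaw n μ).map (fun ρ => ρ i) = expMeasure μ := hi
    have hj' : (lifetimeLaw n μ).map (fun ρ => ρ j) = expMeasure μ := hj
    rw [hi', hj'] at hpair
    have hd : MeasurableSet {q : ℝ × ℝ | q.1 = q.2} := measurableSet_eq_fun measurable_fst measurable_snd
    have h0 : ((expMeasure μ).prod (expMeasure μ)) {q : ℝ × ℝ | q.1 = q.2} = 0 := by
      rw [Measure.measure_prod_null hd]
      refine Eventually.of_forall fun x => ?_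
      have : Prod.mk x ⁻¹' {q : ℝ × ℝ | q.1 = q.2} = {x} := by
        ext y
        simp [eq_comm]
      simp only [this, expMeasure_singleton, Pi.zero_apply]
    rw [← hpair, Measure.map_apply ((measurable_pi_apply i).prodMk (measurable_pi_apply j)) hd]
      at h0
    rw [ae_iff]
    convert h0 using 2
    ext ρ
    simp
  have h' : ∀ᵐ ρ ∂(lifetimeLaw n μ), ∀ i j : Fin n, i ≠ j → ρ i ≠ ρ j := by
    simpa only [ae_all_iff, eventually_imp_distrib_left] using h
  filter_upwards [h'] with ρ hρ i j hij
  by_contra hne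
  exact hρ i j hne hij

/-- The number of components that fail before component `i`. -/
noncomputable def rank (ρ : Fin n → ℝ) (i : Fin n) : ℕ := (Finset.univ.filter fun j => ρ j < ρ i).card

/-- The state after the `k`-th failure, if there are no repairs. -/
noncomputable def orderState (ρ : Fin n → ℝ) (k : ℕ) : Fin n → Bool := fun i => decide (k ≤ rank ρ i)

lemma rank_lt (ρ : Fin n → ℝ) (i : Fin n) : rank ρ i < n := by
  have h : (Finset.univ.filter fun j => ρ j < ρ i) ⊂ Finset.univ := by
    refine Finset.filter_ssubset.2 ⟨i, Finset.mem_univ i, lt_irrefl _⟩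
  simpa [rank] using Finset.card_lt_card h

lemma rank_injective {ρ : Fin n → ℝ} (hρ : Function.Injective ρ) :
    Function.Injective (rank ρ) := by
  have h : ∀ i j, ρ i < ρ j → rank ρ i < rank ρ j := by
    intro i j hij
    refine Finset.card_lt_card ((Finset.ssubset_iff_of_subset ?_).2 ⟨i, by simpa using hij, by simp⟩)
    intro k hk
    simp only [Finset.mem_filter, Finset.mem_univ, true_and] at hk ⊢
    exact hk.trans hij
  intro i j hij
  by_contra hne
  rcases lt_or_gt_of_ne (hρ.ne hne) with h1 | h1
  · exact (h i j h1).ne hij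
  · exact (h j i h1).ne' hij

/-- Without ties the ranks are a bijection onto `0, …, n - 1`, so exactly `k` of them lie below `k`.
-/
lemma numFailed_orderState {ρ : Fin n → ℝ} (hρ : Function.Injective ρ) {k : ℕ} (hk : k ≤ n) :
    numFailed (orderState ρ k) = k := by
  have himg : Finset.univ.image (rank ρ) = Finset.range n := by
    refine Finset.eq_of_subset_of_card_le (fun m hm => ?_) ?_
    · obtain ⟨i, -, rfl⟩ := Finset.mem_image.1 hm
      exact Finset.mem_range.2 (rank_lt ρ i)
    · rw [Finset.card_image_of_injective _ (rank_injective hρ)]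
      simp
  have h : (Finset.univ.filter fun i => orderState ρ k i = false).image (rank ρ)
      = Finset.range k := by
    ext m
    simp only [Finset.mem_image, Finset.mem_filter, Finset.mem_univ, true_and, orderState,
      decide_eq_false_iff_not, not_le, Finset.mem_range]
    constructor
    · rintro ⟨i, hi, rfl⟩
      exact hi
    · intro hm
      have : m ∈ Finset.univ.image (rank ρ) := by
        rw [himg]
        exact Finset.mem_range.2 (hm.trans_le hk)
      obtain ⟨i, -, rfl⟩ := Finset.mem_image.1 this
      exact ⟨i, hm, rfl⟩
  rw [numFailed, ← Finset.card_image_of_injective _ (rank_injective hρ), h, Finset.card_range]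

lemma measurable_orderState (k : ℕ) : Measurable fun ρ : Fin n → ℝ => orderState ρ k := by
  refine measurable_pi_lambda _ fun i => measurable_to_bool ?_
  have h : (fun ρ : Fin n → ℝ => orderState ρ k i) ⁻¹' {true} = {ρ | k ≤ rank ρ i} := by
    ext ρ
    simp [orderState]
  have hr : Measurable fun ρ : Fin n → ℝ => rank ρ i := by
    simp only [rank, Finset.card_filter]
    refine Finset.measurable_sum _ fun j _ => Measurable.ite ?_ measurable_const measurable_const
    exact measurableSet_lt (measurable_pi_apply j) (measurable_pi_apply i)
  rw [h]
  exact measurableSet_le measurable_const hr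

lemma rank_comp (ρ : Fin n → ℝ) (σ : Equiv.Perm (Fin n)) (i : Fin n) :
    rank (ρ ∘ σ) i = rank ρ (σ i) := by
  refine Finset.card_bij (fun j _ => σ j) ?_ (fun _ _ _ _ h => σ.injective h) ?_
  · intro j hj
    simpa using hj
  · intro j hj
    exact ⟨σ.symm j, by simpa using hj, by simp⟩

lemma exists_perm_of_numFailed_eq {x y : Fin n → Bool} (h : numFailed x = numFailed y) :
    ∃ σ : Equiv.Perm (Fin n), y ∘ σ = x := by
  have hcard : Fintype.card {i // x i = false} = Fintype.card {i // y i = false} := by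
    rw [Fintype.card_subtype, Fintype.card_subtype]
    exact h
  let e := Fintype.equivOfCardEq hcard
  refine ⟨e.extendSubtype, ?_⟩
  funext i
  rw [Function.comp_apply]
  by_cases hi : x i = false
  · rw [hi]
    exact e.extendSubtype_mem i hi
  · have := e.extendSubtype_not_mem i hi
    simp only [Bool.not_eq_false] at hi this
    rw [hi, this]

/-- Exchangeability: a permutation of the components carries one state to the other and preserves
the product law. -/
lemma lifetimeLaw_real_orderState_congr (hμ : 0 < μ) (k : ℕ) {x y : Fin n → Bool}
    (h : numFailed x = numFailed y) :
    (lifetimeLaw n μ).real {ρ | orderState ρ k = x}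
      = (lifetimeLaw n μ).real {ρ | orderState ρ k = y} := by
  have := isProbabilityMeasure_expMeasure hμ
  obtain ⟨σ, rfl⟩ := exists_perm_of_numFailed_eq h
  have hmp := measurePreserving_arrowCongr' (fun _ : Fin n => expMeasure μ)
    (fun _ : Fin n => expMeasure μ) σ.symm (MeasurableEquiv.refl ℝ)
    fun _ => MeasurePreserving.id _
  have hm : MeasurableSet {ρ : Fin n → ℝ | orderState ρ k = y ∘ σ} :=
    measurable_orderState k (measurableSet_singleton _)
  rw [measureReal_def, measureReal_def, ← hmp.measure_preimage hm.nullMeasurableSet]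
  congr 2
  ext ρ
  have hcomp : MeasurableEquiv.arrowCongr' σ.symm (MeasurableEquiv.refl ℝ) ρ = ρ ∘ σ := rfl
  have hst : orderState (ρ ∘ σ) k = orderState ρ k ∘ σ := by
    funext i
    simp only [orderState, rank_comp, Function.comp_apply]
  simp only [Set.mem_preimage, Set.mem_ofPred_eq, hcomp, hst]
  exact σ.surjective.injective_comp_right.eq_iff

lemma card_numFailed_eq (k : ℕ) :
    (Finset.univ.filter fun x : Fin n → Bool => numFailed x = k).card = n.choose k := by
  have h : (Finset.powersetCard k (Finset.univ : Finset (Fin n))).card = n.choose k := by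
    rw [Finset.card_powersetCard, Finset.card_univ, Fintype.card_fin]
  rw [← h]
  refine Finset.card_nbij' (fun x => Finset.univ.filter fun i => x i = false)
    (fun s i => decide (i ∉ s)) ?_ ?_ ?_ ?_
  · intro x hx
    have hx' : numFailed x = k := by simpa using hx
    simpa [Finset.mem_powersetCard, numFailed] using hx'
  · intro s hs
    have hs' : s.card = k := by simpa using hs
    have : numFailed (fun i => decide (i ∉ s)) = k := by simpa [numFailed] using hs'
    simpa using this
  · intro x _
    funext i
    cases hx : x i <;> simp [hx]
  · intro s _
    ext i
    simp

lemma lifetimeLaw_real_orderState (hμ : 0 < μ) {k : ℕ} (hk : k ≤ n) {x : Fin n → Bool}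
    (hx : numFailed x = k) :
    (lifetimeLaw n μ).real {ρ | orderState ρ k = x} = 1 / (n.choose k : ℝ) := by
  have := isProbabilityMeasure_expMeasure hμ
  have hms := measurable_orderState (n := n) k
  have hsum := sum_measureReal_preimage_singleton (μ := lifetimeLaw n μ)
    (f := fun ρ => orderState ρ k)
    (Finset.univ.filter fun x : Fin n → Bool => numFailed x = k)
    fun x _ => hms (measurableSet_singleton x)
  have hone : (lifetimeLaw n μ).real ((fun ρ => orderState ρ k) ⁻¹'
      (Finset.univ.filter fun x : Fin n → Bool => numFailed x = k : Finset _)) = 1 := by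
    have hmem : ((fun ρ => orderState ρ k) ⁻¹'
        (Finset.univ.filter fun x : Fin n → Bool => numFailed x = k : Finset _))
          ∈ ae (lifetimeLaw n μ) := by
      filter_upwards [ae_lifetimeLaw_injective hμ] with ρ hρ
      simpa using numFailed_orderState hρ hk
    rw [measureReal_def, (mem_ae_iff_prob_eq_one (hms (MeasurableSet.of_discrete))).1 hmem,
      ENNReal.toReal_one]
  have hcongr : ∀ y ∈ Finset.univ.filter (fun x : Fin n → Bool => numFailed x = k),
      (lifetimeLaw n μ).real ((fun ρ => orderState ρ k) ⁻¹' {y})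
        = (lifetimeLaw n μ).real {ρ | orderState ρ k = x} := fun y hy =>
    lifetimeLaw_real_orderState_congr hμ k (by rw [(Finset.mem_filter.1 hy).2, hx])
  rw [hone, Finset.sum_congr rfl hcongr, Finset.sum_const, card_numFailed_eq, nsmul_eq_mul] at hsum
  have hpos : (0 : ℝ) < n.choose k := by exact_mod_cast Nat.choose_pos hk
  field_simp
  linarith

/-- The indicator that the system works after the `k`-th failure, if there are no repairs. -/
noncomputable def worksAfter (Φ : (Fin n → Bool) → Bool) (k : ℕ) (ρ : Fin n → ℝ) : ℝ :=
  if Φ (orderState ρ k) = true then 1 else 0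

lemma measurable_worksAfter (k : ℕ) : Measurable (worksAfter Φ k) :=
  (measurable_of_finite fun x : Fin n → Bool => if Φ x = true then (1 : ℝ) else 0).comp
    (measurable_orderState k)

lemma integrable_worksAfter (hμ : 0 < μ) (k : ℕ) :
    Integrable (worksAfter Φ k) (lifetimeLaw n μ) := by
  have := isProbabilityMeasure_expMeasure hμ
  refine Integrable.of_bound (measurable_worksAfter k).aestronglyMeasurable 1
    (Eventually.of_forall fun ρ => ?_)
  rw [worksAfter]
  split_ifs <;> simp

/-- The state after `k` failures is uniform among the states with `k` failed components, and the
survival signature is the average of `Φ` over these. -/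
lemma integral_worksAfter (hμ : 0 < μ) {k : ℕ} (hk : k ≤ n) :
    ∫ ρ, worksAfter Φ k ρ ∂(lifetimeLaw n μ) = survivalSignature Φ k := by
  have := isProbabilityMeasure_expMeasure hμ
  have hms := measurable_orderState (n := n) k
  have hae : worksAfter Φ k =ᵐ[lifetimeLaw n μ] fun ρ =>
      ∑ x ∈ Finset.univ.filter (fun x : Fin n → Bool => numFailed x = k),
        {ρ | orderState ρ k = x}.indicator (fun _ => if Φ x = true then (1 : ℝ) else 0) ρ := by
    filter_upwards [ae_lifetimeLaw_injective hμ] with ρ hρ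
    rw [Finset.sum_eq_single (orderState ρ k)]
    · simp [worksAfter]
    · intro x _ hx
      exact Set.indicator_of_notMem (fun h => hx h.symm) _
    · intro h
      exact absurd (by simpa using numFailed_orderState hρ hk) h
  have hmx : ∀ x, MeasurableSet {ρ : Fin n → ℝ | orderState ρ k = x} :=
    fun x => hms (measurableSet_singleton x)
  rw [integral_congr_ae hae, integral_finsetSum _ fun x _ =>
    (integrable_const _).indicator (hmx x), survivalSignature_eq hk, Finset.mul_sum]
  refine Finset.sum_congr rfl fun x hx => ?_
  rw [integral_indicator_const _ (hmx x),
    lifetimeLaw_real_orderState hμ hk (Finset.mem_filter.1 hx).2, smul_eq_mul]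

lemma orderState_antitone (ρ : Fin n → ℝ) : Antitone (orderState ρ) := by
  intro k l hkl i
  simp only [orderState]
  by_cases h : l ≤ rank ρ i
  · simp [h, hkl.trans h]
  · simp [h]

/-- If no two components fail at the same time, a cycle ends with the `k`-th failure for some
`k ≤ r`, the system works after the earlier failures, and `k = r` unless the system is failed. -/
lemma cycleState_eq_orderState (hΦ : IsSemiCoherent Φ) (hr1 : 1 ≤ r) {ρ : Fin n → ℝ}
    (hpos : ∀ i, 0 < ρ i) (hinj : Function.Injective ρ) :
    ∃ k, 1 ≤ k ∧ k ≤ r ∧ numFailed (cycleState Φ r ρ) = k ∧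
      cycleState Φ r ρ = orderState ρ k ∧ (∀ j < k, Φ (orderState ρ j) = true) ∧
      (Φ (cycleState Φ r ρ) = true → k = r) := by
  have hL := cycleLength_pos (r := r) hΦ hr1 hpos
  set L := cycleLength Φ r ρ with hLdef
  -- A time just before the end of the cycle, by which every failure preceding `L` has occurred.
  obtain ⟨t, ht, ht0, htL⟩ : ∃ t, (∀ i, ρ i < L → ρ i ≤ t) ∧ 0 ≤ t ∧ t < L := by
    have h : ∀ i, ∀ᶠ t in 𝓝[<] L, ρ i < L → ρ i ≤ t := by
      intro i
      by_cases hi : ρ i < L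
      · filter_upwards [Ioo_mem_nhdsLT hi] with t ht _ using ht.1.le
      · exact Eventually.of_forall fun _ h => absurd h hi
    obtain ⟨t, ⟨h1, h2⟩⟩ := ((eventually_all.2 h).and (Ioo_mem_nhdsLT hL)).exists
    exact ⟨t, h1, h2.1.le, h2.2⟩
  have hmem : ∀ i, cycleState Φ r ρ i = false ↔ ρ i ≤ L := by
    intro i
    simp [cycleState, stateAt, ← hLdef]
  have hmem' : ∀ i, stateAt ρ t i = false ↔ ρ i < L := by
    intro i
    simp only [stateAt, decide_eq_false_iff_not, not_lt]
    exact ⟨fun h => h.trans_lt htL, ht i⟩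
  -- Without ties at most one component fails at `L` itself.
  have hcard : numFailed (cycleState Φ r ρ) ≤ numFailed (stateAt ρ t) + 1 := by
    simp only [numFailed, hmem, hmem']
    have hsub : (Finset.univ.filter fun i => ρ i ≤ L) ⊆
        (Finset.univ.filter fun i => ρ i < L) ∪ (Finset.univ.filter fun i => ρ i = L) := by
      intro i
      simp only [Finset.mem_union, Finset.mem_filter, Finset.mem_univ, true_and]
      exact fun h => lt_or_eq_of_le h
    refine (Finset.card_le_card hsub).trans ((Finset.card_union_le _ _).trans ?_)
    refine Nat.add_le_add_left (Finset.card_le_one.2 fun i hi j hj => ?_) _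
    simp only [Finset.mem_filter, Finset.mem_univ, true_and] at hi hj
    exact hinj (hi.trans hj.symm)
  obtain ⟨hlt, hwork⟩ := (not_needsRepair_iff _).1 ((lt_cycleLength_iff hΦ ρ ht0).1 htL)
  have hN := needsRepair_cycleState (r := r) hΦ ρ
  refine ⟨_, ?_, by omega, rfl, ?_, ?_, ?_⟩
  · by_contra! h0
    have : cycleState Φ r ρ = fun _ => true := by
      funext i
      by_contra hi
      simp only [Bool.not_eq_true] at hi
      have h1 : numFailed (cycleState Φ r ρ) = 0 := by omega
      rw [numFailed, Finset.card_eq_zero, Finset.filter_eq_empty_iff] at h1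
      exact h1 (Finset.mem_univ i) hi
    rw [this] at hN
    exact not_needsRepair_all_working hΦ hr1 hN
  · funext i
    by_cases hi : cycleState Φ r ρ i = false
    · rw [hi, eq_comm, orderState, decide_eq_false_iff_not, not_le]
      refine Finset.card_lt_card ((Finset.ssubset_iff_of_subset ?_).2
        ⟨i, by simpa using hi, by simp⟩)
      intro j hj
      simp only [Finset.mem_filter, Finset.mem_univ, true_and, hmem] at hj hi ⊢
      exact hj.le.trans hi
    · have hi' : L < ρ i := by simpa [hmem] using hi
      simp only [Bool.not_eq_false] at hi
      rw [hi, eq_comm, orderState, decide_eq_true_eq]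
      refine Finset.card_le_card fun j hj => ?_
      simp only [Finset.mem_filter, Finset.mem_univ, true_and, hmem] at hj ⊢
      exact hj.trans_lt hi'
  · intro j hj
    -- At least `k - 1 ≥ j` components have failed by `t`, so any component working then is not
    -- among the first `j` to fail. The system works at `t`, hence by monotonicity after `j`
    -- failures.
    have hle : stateAt ρ t ≤ orderState ρ j := by
      intro i
      by_cases hi : stateAt ρ t i = true
      · have hi' : L ≤ ρ i := by
          have := (hmem' i).not
          simpa [hi] using this
        have : orderState ρ j i = true := by
          rw [orderState, decide_eq_true_eq]
          refine (show j ≤ numFailed (stateAt ρ t) by omega).trans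
            (Finset.card_le_card fun l hl => ?_)
          simp only [Finset.mem_filter, Finset.mem_univ, true_and, hmem'] at hl ⊢
          exact hl.trans_le hi'
        rw [this]
        exact le_top
      · simp only [Bool.not_eq_true] at hi
        rw [hi]
        exact bot_le
    have := hΦ.monotone hle
    rw [hwork] at this
    exact top_le_iff.1 this
  · intro h
    rcases hN with h1 | h1
    · omega
    · rw [h] at h1
      exact absurd h1 (by simp)

/-- If the cycle ends with a system failure at the `k`-th component failure, `worksAfter` drops from
1 to 0 exactly at `k` and the sum selects that term. Otherwise it is 1 up to `r` and only the last
term survives. The form is linear in `worksAfter`, whose means are known. -/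
lemma repairCost_cycleState (hΦ : IsSemiCoherent Φ) (hr1 : 1 ≤ r) (csys : ℝ) (ccmp : ℕ → ℝ)
    {ρ : Fin n → ℝ} (hpos : ∀ i, 0 < ρ i) (hinj : Function.Injective ρ) :
    repairCost Φ csys ccmp (cycleState Φ r ρ)
      = ∑ k ∈ Finset.Icc 1 r, (worksAfter Φ (k - 1) ρ - worksAfter Φ k ρ) * (csys + ccmp k)
        + worksAfter Φ r ρ * ccmp r := by
  obtain ⟨k, hk1, hkr, hnum, hst, hwork, hr⟩ := cycleState_eq_orderState hΦ hr1 hpos hinj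
  have hw1 : ∀ j < k, worksAfter Φ j ρ = 1 := fun j hj => by rw [worksAfter, if_pos (hwork j hj)]
  rw [repairCost, hnum]
  by_cases hf : Φ (cycleState Φ r ρ) = true
  · obtain rfl := hr hf
    have hw : ∀ j ≤ k, worksAfter Φ j ρ = 1 := by
      intro j hj
      rcases hj.lt_or_eq with h | rfl
      · exact hw1 j h
      · rw [worksAfter, ← hst, if_pos hf]
    rw [if_neg (by simp [hf]), hw k le_rfl, Finset.sum_eq_zero]
    · ring
    · intro j hj
      have := Finset.mem_Icc.1 hj
      rw [hw j this.2, hw (j - 1) (by omega)]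
      ring
  · have hw0 : ∀ j, k ≤ j → worksAfter Φ j ρ = 0 := by
      intro j hj
      have := hΦ.monotone (orderState_antitone ρ hj)
      rw [← hst] at this
      simp only [Bool.not_eq_true] at hf
      rw [hf] at this
      rw [worksAfter, le_bot_iff.1 this, if_neg (by simp)]
    rw [if_pos (by simpa using hf), hw0 r hkr, Finset.sum_eq_single k]
    · rw [hw0 k le_rfl, hw1 (k - 1) (by omega)]
      ring
    · intro j hj hjk
      have := Finset.mem_Icc.1 hj
      rcases lt_or_gt_of_ne hjk with h | h
      · rw [hw1 j h, hw1 (j - 1) (by omega)]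
        ring
      · rw [hw0 j h.le, hw0 (j - 1) (by omega)]
        ring
    · intro h
      exact absurd (Finset.mem_Icc.2 ⟨hk1, hkr⟩) h

lemma integrable_repairCost (hΦ : IsSemiCoherent Φ) (hμ : 0 < μ) (csys : ℝ) (ccmp : ℕ → ℝ) :
    Integrable (fun ρ => repairCost Φ csys ccmp (cycleState Φ r ρ)) (lifetimeLaw n μ) := by
  have := isProbabilityMeasure_expMeasure hμ
  obtain ⟨c, hc⟩ := (Set.finite_range fun x => ‖repairCost Φ csys ccmp x‖).bddAbove
  exact Integrable.of_bound ((measurable_of_finite (repairCost Φ csys ccmp)).comp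
    (measurable_cycleState hΦ)).aestronglyMeasurable c
    (Eventually.of_forall fun ρ => hc ⟨_, rfl⟩)

theorem integral_repairCost (hΦ : IsSemiCoherent Φ) (hμ : 0 < μ) (hr1 : 1 ≤ r) (hrn : r ≤ n)
    (csys : ℝ) (ccmp : ℕ → ℝ) :
    ∫ ρ, repairCost Φ csys ccmp (cycleState Φ r ρ) ∂(lifetimeLaw n μ)
      = ∑ k ∈ Finset.Icc 1 r, signature Φ k * (csys + ccmp k)
        + (∑ k ∈ Finset.Icc (r + 1) n, signature Φ k) * ccmp r := by
  have hae : (fun ρ => repairCost Φ csys ccmp (cycleState Φ r ρ)) =ᵐ[lifetimeLaw n μ]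
      fun ρ => ∑ k ∈ Finset.Icc 1 r,
        (worksAfter Φ (k - 1) ρ - worksAfter Φ k ρ) * (csys + ccmp k)
        + worksAfter Φ r ρ * ccmp r := by
    filter_upwards [ae_lifetimeLaw_pos hμ, ae_lifetimeLaw_injective hμ] with ρ h1 h2
    exact repairCost_cycleState hΦ hr1 csys ccmp h1 h2
  have hint := fun k => integrable_worksAfter (Φ := Φ) hμ k
  have hterm : ∀ k ∈ Finset.Icc 1 r, Integrable (fun ρ =>
      (worksAfter Φ (k - 1) ρ - worksAfter Φ k ρ) * (csys + ccmp k)) (lifetimeLaw n μ) :=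
    fun k _ => ((hint (k - 1)).sub (hint k)).mul_const _
  rw [integral_congr_ae hae, integral_add (integrable_finsetSum _ hterm) ((hint r).mul_const _),
    integral_finsetSum _ hterm, integral_mul_const, integral_worksAfter hμ hrn,
    sum_signature_tail hΦ hrn]
  congr 1
  refine Finset.sum_congr rfl fun k hk => ?_
  have hk' := (Finset.mem_Icc.1 hk).2.trans hrn
  rw [integral_mul_const, integral_sub (hint _) (hint _), integral_worksAfter hμ hk',
    integral_worksAfter hμ (by omega), signature]

theorem lifetimeLaw_real_systemFailed (hΦ : IsSemiCoherent Φ) (hμ : 0 < μ) (hr1 : 1 ≤ r)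
    (hrn : r ≤ n) :
    (lifetimeLaw n μ).real {ρ | Φ (cycleState Φ r ρ) = false}
      = ∑ k ∈ Finset.Icc 1 r, signature Φ k := by
  -- With system cost 1 and component cost 0 the cost is the indicator of a system failure.
  have h := integral_repairCost hΦ hμ hr1 hrn 1 fun _ => 0
  have hm : MeasurableSet {ρ : Fin n → ℝ | Φ (cycleState Φ r ρ) = false} :=
    measurable_cycleState hΦ (MeasurableSet.of_discrete (s := {x | Φ x = false}))
  have hfun : (fun ρ => repairCost Φ 1 (fun _ => 0) (cycleState Φ r ρ))
      = {ρ | Φ (cycleState Φ r ρ) = false}.indicator fun _ => (1 : ℝ) := by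
    funext ρ
    simp [repairCost, Set.indicator]
  rw [hfun, integral_indicator_const _ hm] at h
  simpa using h

end RepairPolicy

namespace RepairPolicy

/-! ### Rewards accumulated up to a first exit -/

section Wald

variable {Ω α : Type*} [MeasurableSpace Ω] [MeasurableSpace α] {P : Measure Ω}
  {Y : ℕ → Ω → α} {lam : Measure α} {y₀ : α} {A : Set α}

lemma measurableSet_forall_lt_mem (hA : MeasurableSet A) (m : ℕ) :
    MeasurableSet {h : ℕ → α | ∀ j < m, h j ∈ A} := by
  simp only [Set.ofPred_forall]
  exact MeasurableSet.iInter fun j => MeasurableSet.iInter fun _ => measurable_pi_apply j hA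

/-- Padding with `y₀` puts every past in the same sequence space; the event reads only the entries
before `m`, which are not padded. -/
lemma indepFun_indicator_past {β : Type*} [MeasurableSpace β]
    (hind : ∀ m, IndepFun (fun ω j => if j < m then Y j ω else y₀) (Y m) P)
    (hA : MeasurableSet A) {g : α → β} (hg : Measurable g) (m : ℕ) :
    IndepFun ({ω | ∀ j < m, Y j ω ∈ A}.indicator fun _ => (1 : ℝ)) (fun ω => g (Y m ω)) P := by
  have hone : Measurable fun _ : ℕ → α => (1 : ℝ) := measurable_const
  have h := (hind m).comp (hone.indicator (measurableSet_forall_lt_mem hA m)) hg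
  have hV : ({h : ℕ → α | ∀ j < m, h j ∈ A}.indicator fun _ => (1 : ℝ)) ∘
      (fun ω j => if j < m then Y j ω else y₀)
        = {ω | ∀ j < m, Y j ω ∈ A}.indicator fun _ => (1 : ℝ) := by
    funext ω
    have : (∀ j < m, (if j < m then Y j ω else y₀) ∈ A) ↔ ∀ j < m, Y j ω ∈ A :=
      forall₂_congr fun j hj => by rw [if_pos hj]
    simp only [Function.comp_apply, Set.indicator, Set.mem_ofPred_eq]
    by_cases h : ∀ j < m, Y j ω ∈ A
    · rw [if_pos h, if_pos (this.2 h)]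
    · rw [if_neg h, if_neg (mt this.1 h)]
  rw [hV] at h
  exact h

lemma measurableSet_past (hY : ∀ m, Measurable (Y m)) (hA : MeasurableSet A) (m : ℕ) :
    MeasurableSet {ω | ∀ j < m, Y j ω ∈ A} :=
  (measurable_pi_lambda _ fun j => hY j) (measurableSet_forall_lt_mem hA m)

variable [IsProbabilityMeasure P]

lemma measureReal_past (hY : ∀ m, Measurable (Y m)) (hlaw : ∀ m, P.map (Y m) = lam)
    (hind : ∀ m, IndepFun (fun ω j => if j < m then Y j ω else y₀) (Y m) P)
    (hA : MeasurableSet A) (m : ℕ) :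
    P.real {ω | ∀ j < m, Y j ω ∈ A} = lam.real A ^ m := by
  induction m with
  | zero => simp
  | succ m ih =>
    have hmA : Measurable (A.indicator fun _ => (1 : ℝ)) := measurable_const.indicator hA
    have hms := measurableSet_past hY hA
    have h := (indepFun_indicator_past hind hA hmA m).integral_fun_mul_eq_mul_integral
      (measurable_const.indicator (hms m)).aestronglyMeasurable
      (hmA.comp (hY m)).aestronglyMeasurable
    have hprod : (fun ω => {ω | ∀ j < m, Y j ω ∈ A}.indicator (fun _ => (1 : ℝ)) ω
        * A.indicator (fun _ => (1 : ℝ)) (Y m ω))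
        = {ω | ∀ j < m + 1, Y j ω ∈ A}.indicator fun _ => (1 : ℝ) := by
      funext ω
      have : (∀ j < m + 1, Y j ω ∈ A) ↔ (∀ j < m, Y j ω ∈ A) ∧ Y m ω ∈ A := by
        simp only [Nat.lt_succ_iff_lt_or_eq, or_imp, forall_and, forall_eq]
      simp only [Set.indicator, Set.mem_ofPred_eq]
      by_cases h1 : ∀ j < m, Y j ω ∈ A
      · by_cases h2 : Y m ω ∈ A
        · rw [if_pos h1, if_pos h2, if_pos (this.2 ⟨h1, h2⟩), one_mul]
        · rw [if_neg h2, if_neg fun h => h2 (this.1 h).2, mul_zero]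
      · rw [if_neg h1, if_neg fun h => h1 (this.1 h).1, zero_mul]
    have hY1 : ∫ ω, A.indicator (fun _ => (1 : ℝ)) (Y m ω) ∂P = lam.real A := by
      rw [← hlaw m, ← integral_map (hY m).aemeasurable hmA.aestronglyMeasurable,
        integral_indicator_const _ hA]
      simp
    rw [hprod, integral_indicator_const _ (hms (m + 1)), hY1,
      integral_indicator_const _ (hms m), ih] at h
    simpa [pow_succ] using h

lemma ae_exists_notMem (hY : ∀ m, Measurable (Y m)) (hlaw : ∀ m, P.map (Y m) = lam)
    (hind : ∀ m, IndepFun (fun ω j => if j < m then Y j ω else y₀) (Y m) P)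
    (hA : MeasurableSet A) (hq : lam.real A < 1) : ∀ᵐ ω ∂P, ∃ m, Y m ω ∉ A := by
  have h0 : P.real {ω | ∀ m, Y m ω ∈ A} = 0 := by
    refine le_antisymm (ge_of_tendsto' (tendsto_pow_atTop_nhds_zero_of_lt_one
      measureReal_nonneg hq) fun m => ?_) measureReal_nonneg
    rw [← measureReal_past hY hlaw hind hA m]
    exact measureReal_mono fun ω hω j _ => hω j
  rw [measureReal_eq_zero_iff] at h0
  rw [ae_iff]
  simpa using h0

/-- The sum of the rewards `g (Y m)` up to and including the first exit from `A`. -/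
theorem integral_tsum_until_exit (hY : ∀ m, Measurable (Y m)) (hlaw : ∀ m, P.map (Y m) = lam)
    (hind : ∀ m, IndepFun (fun ω j => if j < m then Y j ω else y₀) (Y m) P)
    (hA : MeasurableSet A) (hq : lam.real A < 1) {g : α → ℝ} (hg : Measurable g)
    (hgi : Integrable g lam) :
    Integrable (fun ω => ∑' m, {ω | ∀ j < m, Y j ω ∈ A}.indicator (fun _ => (1 : ℝ)) ω
        * g (Y m ω)) P ∧
      ∫ ω, ∑' m, {ω | ∀ j < m, Y j ω ∈ A}.indicator (fun _ => (1 : ℝ)) ω * g (Y m ω) ∂P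
        = (∫ y, g y ∂lam) / (1 - lam.real A) := by
  have hms := measurableSet_past hY hA
  -- The indicator concerns only indices below `m`, so the exiting term is counted, and independence
  -- gives `F m` the mean `(lam.real A)^m` times that of `g`.
  set F : ℕ → Ω → ℝ := fun m ω =>
    {ω | ∀ j < m, Y j ω ∈ A}.indicator (fun _ => (1 : ℝ)) ω * g (Y m ω) with hF
  have hgY : ∀ m, Integrable (fun ω => g (Y m ω)) P := fun m => by
    have := hgi
    rw [← hlaw m] at this
    exact this.comp_measurable (hY m)
  have hFm : ∀ m, Measurable (F m) := fun m =>
    (measurable_const.indicator (hms m)).mul (hg.comp (hY m))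
  have hFi : ∀ m, Integrable (F m) P := fun m =>
    (indepFun_indicator_past hind hA hg m).integrable_mul
      ((integrable_const _).indicator (hms m)) (hgY m)
  have hint : ∀ f : α → ℝ, Measurable f → ∀ m,
      ∫ ω, {ω | ∀ j < m, Y j ω ∈ A}.indicator (fun _ => (1 : ℝ)) ω * f (Y m ω) ∂P
        = lam.real A ^ m * ∫ y, f y ∂lam := by
    intro f hf m
    rw [(indepFun_indicator_past hind hA hf m).integral_fun_mul_eq_mul_integral
      (measurable_const.indicator (hms m)).aestronglyMeasurable
      (hf.comp (hY m)).aestronglyMeasurable, integral_indicator_const _ (hms m),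
      measureReal_past hY hlaw hind hA m, smul_eq_mul, mul_one, ← hlaw m,
      integral_map (hY m).aemeasurable hf.aestronglyMeasurable]
  have hnorm : ∀ m, ∫ ω, ‖F m ω‖ ∂P = lam.real A ^ m * ∫ y, ‖g y‖ ∂lam := by
    intro m
    rw [← hint _ hg.norm m]
    refine integral_congr_ae (Eventually.of_forall fun ω => ?_)
    simp only [hF, norm_mul]
    congr 1
    simp only [Set.indicator]
    split_ifs <;> simp
  have hsum : Summable fun m => ∫ ω, ‖F m ω‖ ∂P := by
    simp only [hnorm]
    exact (summable_geometric_of_lt_one measureReal_nonneg hq).mul_right _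
  have hfin : ∑' m, eLpNorm (F m) 1 P ≠ ∞ := by
    have : ∀ m, eLpNorm (F m) 1 P = ENNReal.ofReal (∫ ω, ‖F m ω‖ ∂P) := fun m => by
      rw [eLpNorm_one_eq_lintegral_enorm, ofReal_integral_norm_eq_lintegral_enorm (hFi m)]
    simp only [this]
    exact hsum.tsum_ofReal_ne_top
  -- Almost everywhere the series converges absolutely, so the `tsum` is the limit of its partial
  -- sums and not the default value 0.
  have hsummable := summable_norm_of_tsum_eLpNorm_ne_top le_rfl
    (fun m => (hFm m).aestronglyMeasurable) hfin
  refine ⟨⟨?_, ?_⟩, ?_⟩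
  · refine aestronglyMeasurable_of_tendsto_ae atTop
      (f := fun N ω => ∑ m ∈ Finset.range N, F m ω) (fun N =>
        (Finset.measurable_fun_sum _ fun m _ => hFm m).aestronglyMeasurable) ?_
    filter_upwards [hsummable] with ω hω
    exact hω.of_norm.hasSum.tendsto_sum_nat
  · refine lt_of_le_of_lt (lintegral_mono fun ω => enorm_tsum_le_tsum_enorm (f := fun m => F m ω)) ?_
    rw [lintegral_tsum fun m => (hFm m).enorm.aemeasurable]
    simp only [eLpNorm_one_eq_lintegral_enorm] at hfin
    exact hfin.lt_top
  · rw [← (hasSum_integral_of_summable_integral_norm hFi hsum).tsum_eq]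
    simp only [hF, hint g hg]
    rw [tsum_mul_right, tsum_geometric_of_lt_one measureReal_nonneg hq]
    field_simp

end Wald

/-! ### The renewal-reward theorem -/

section RenewalReward

variable {T c : ℕ → ℝ} {a b : ℝ}

lemma tendsto_atTop_of_tendsto_div (ha : 0 < a)
    (hT : Tendsto (fun m : ℕ => T m / m) atTop (𝓝 a)) : Tendsto T atTop atTop := by
  have h := hT.pos_mul_atTop ha tendsto_natCast_atTop_atTop
  refine h.congr' ?_
  filter_upwards [eventually_gt_atTop 0] with m hm
  have : (m : ℝ) ≠ 0 := by positivity
  field_simp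

lemma finite_renewals (hT : Tendsto T atTop atTop) (t : ℝ) : {m : ℕ | T (m + 1) ≤ t}.Finite := by
  have h := ((tendsto_add_atTop_iff_nat 1).2 hT).eventually_gt_atTop t
  rw [← Nat.cofinite_eq_atTop] at h
  simpa [Filter.eventually_cofinite] using h

/-- The renewal-reward theorem along a fixed path. -/
theorem tendsto_reward_div (h0 : T 0 = 0) (hmono : Monotone T) (ha : 0 < a)
    (hT : Tendsto (fun m : ℕ => T m / m) atTop (𝓝 a))
    (hc : Tendsto (fun m : ℕ => (∑ i ∈ Finset.range m, c i) / m) atTop (𝓝 b)) :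
    Tendsto (fun t : ℝ => (∑' m, if T (m + 1) ≤ t then c m else 0) / t) atTop (𝓝 (b / a)) := by
  have hTinf := tendsto_atTop_of_tendsto_div ha hT
  have hex : ∀ t, ∃ m, t < T (m + 1) := fun t =>
    (((tendsto_add_atTop_iff_nat 1).2 hTinf).eventually_gt_atTop t).exists
  classical
  -- `N t` is the number of renewals up to `t`. For `t ≥ 0`, `T (N t) ≤ t < T (N t + 1)` squeezes `t
  -- / N t` to `a`, and the reward per time is the reward per renewal divided by `t / N t`.
  let N : ℝ → ℕ := fun t => Nat.find (hex t)
  have hN1 : ∀ t, t < T (N t + 1) := fun t => Nat.find_spec (hex t)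
  have hNiff : ∀ t m, T (m + 1) ≤ t ↔ m < N t := by
    intro t m
    constructor
    · intro h
      by_contra! hm
      exact absurd (h.trans_lt (hN1 t)) (not_lt.2 (hmono (by omega)))
    · intro h
      exact not_lt.1 (Nat.find_min (hex t) h)
  have hN0 : ∀ t, 0 ≤ t → T (N t) ≤ t := by
    intro t ht
    rcases Nat.eq_zero_or_pos (N t) with h | h
    · rw [h, h0]
      exact ht
    · obtain ⟨m, hm⟩ := Nat.exists_eq_succ_of_ne_zero h.ne'
      rw [hm]
      exact (hNiff t m).2 (by omega)
  have hNinf : Tendsto N atTop atTop := by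
    refine tendsto_atTop.2 fun K => ?_
    filter_upwards [eventually_ge_atTop (T (K + 1))] with t ht
    exact ((hNiff t K).1 ht).le
  have hsum : ∀ t, (∑' m, if T (m + 1) ≤ t then c m else 0) = ∑ i ∈ Finset.range (N t), c i := by
    intro t
    rw [tsum_eq_sum (s := Finset.range (N t))]
    · exact Finset.sum_congr rfl fun i hi => if_pos ((hNiff t i).2 (Finset.mem_range.1 hi))
    · intro i hi
      exact if_neg fun h => hi (Finset.mem_range.2 ((hNiff t i).1 h))
  have hup : Tendsto (fun m : ℕ => T (m + 1) / m) atTop (𝓝 a) := by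
    have h1 := ((tendsto_add_atTop_iff_nat 1).2 hT).mul
      ((tendsto_const_nhds (x := (1 : ℝ))).add tendsto_one_div_atTop_nhds_zero_nat)
    rw [add_zero, mul_one] at h1
    refine h1.congr' ?_
    filter_upwards [eventually_gt_atTop 0] with m hm
    have : (m : ℝ) ≠ 0 := by positivity
    push_cast
    field_simp
  have htN : Tendsto (fun t => t / N t) atTop (𝓝 a) := by
    refine tendsto_of_tendsto_of_tendsto_of_le_of_le' (hT.comp hNinf) (hup.comp hNinf) ?_ ?_
    · filter_upwards [eventually_ge_atTop 0] with t ht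
      exact div_le_div_of_nonneg_right (hN0 t ht) (by positivity)
    · exact Eventually.of_forall fun t => div_le_div_of_nonneg_right (hN1 t).le (by positivity)
  refine ((hc.comp hNinf).div htN ha.ne').congr' ?_
  filter_upwards [hNinf.eventually_gt_atTop 0] with t ht
  have : (N t : ℝ) ≠ 0 := by positivity
  simp only [Pi.div_apply, Function.comp_apply, hsum]
  rw [div_div_div_cancel_right₀ this]

end RenewalReward

end RepairPolicy

/-! ### The sequence of cycles: common law, independence and the strong law -/

namespace RepairPolicy

variable {n : ℕ} {Φ : (Fin n → Bool) → Bool} {r : ℕ} {μ : ℝ}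

/-- The length of the cycle before the `(m + 1)`-st repair, and the state found by that repair. -/
noncomputable def cycle (Φ : (Fin n → Bool) → Bool) (r : ℕ) (m : ℕ) (ℓ : Fin n → ℕ → ℝ) :
    ℝ × (Fin n → Bool) :=
  (cycleLength Φ r (residual Φ r ℓ m), cycleState Φ r (residual Φ r ℓ m))

/-- The cycles before the `m`-th repair, filled up with a constant. -/
noncomputable def pastCycles (Φ : (Fin n → Bool) → Bool) (r : ℕ) (m : ℕ) (ℓ : Fin n → ℕ → ℝ) :
    ℕ → ℝ × (Fin n → Bool) :=
  fun j => if j < m then cycle Φ r j ℓ else (0, fun _ => true)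

/-- The law of the length and of the final state of a cycle. -/
noncomputable def cycleLaw (Φ : (Fin n → Bool) → Bool) (r : ℕ) (μ : ℝ) :
    Measure (ℝ × (Fin n → Bool)) :=
  (lifetimeLaw n μ).map fun ρ => (cycleLength Φ r ρ, cycleState Φ r ρ)

lemma measurable_residual (hΦ : IsSemiCoherent Φ) (m : ℕ) :
    Measurable fun ℓ : Fin n → ℕ → ℝ => residual Φ r ℓ m := by
  have hcol : ∀ m, Measurable fun (ℓ : Fin n → ℕ → ℝ) (i : Fin n) => ℓ i m := fun m =>
    measurable_pi_lambda _ fun i => (measurable_pi_apply m).comp (measurable_pi_apply i)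
  induction m with
  | zero => exact hcol 0
  | succ m ih =>
    have h := (measurable_renew (r := r) hΦ).comp (ih.prodMk (hcol (m + 1)))
    simpa only [residual, Function.comp_def] using h

lemma measurable_cycle_pair (hΦ : IsSemiCoherent Φ) :
    Measurable fun ρ : Fin n → ℝ => (cycleLength Φ r ρ, cycleState Φ r ρ) :=
  (measurable_cycleLength hΦ).prodMk (measurable_cycleState hΦ)

lemma measurable_cycle (hΦ : IsSemiCoherent Φ) (m : ℕ) : Measurable (cycle Φ r m) :=
  (measurable_cycle_pair hΦ).comp (measurable_residual hΦ m)

lemma measurable_pastCycles (hΦ : IsSemiCoherent Φ) (m : ℕ) : Measurable (pastCycles Φ r m) := by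
  refine measurable_pi_lambda _ fun j => ?_
  by_cases h : j < m
  · simpa only [pastCycles, if_pos h] using measurable_cycle hΦ j
  · simpa only [pastCycles, if_neg h] using measurable_const

lemma residual_congr {ℓ ℓ' : Fin n → ℕ → ℝ} {m : ℕ} (h : ∀ i, ∀ j ≤ m, ℓ i j = ℓ' i j) :
    residual Φ r ℓ m = residual Φ r ℓ' m := by
  induction m with
  | zero => exact funext fun i => h i 0 le_rfl
  | succ m ih =>
    have hnew : (fun i => ℓ i (m + 1)) = fun i => ℓ' i (m + 1) :=
      funext fun i => h i (m + 1) le_rfl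
    rw [residual, residual, ih fun i j hj => h i j (hj.trans m.le_succ), hnew]

lemma pastCycles_congr {ℓ ℓ' : Fin n → ℕ → ℝ} {m : ℕ} (h : ∀ i, ∀ j ≤ m, ℓ i j = ℓ' i j) :
    pastCycles Φ r m ℓ = pastCycles Φ r m ℓ' := by
  funext j
  simp only [pastCycles]
  split_ifs with hj
  · rw [cycle, cycle, residual_congr fun i k hk => h i k (hk.trans hj.le)]
  · rfl

lemma pastCycles_succ (ℓ : Fin n → ℕ → ℝ) (m : ℕ) :
    pastCycles Φ r (m + 1) ℓ = Function.update (pastCycles Φ r m ℓ) m (cycle Φ r m ℓ) := by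
  funext j
  simp only [pastCycles, Function.update_apply]
  by_cases h : j = m
  · subst h
    simp
  · have : j < m + 1 ↔ j < m := by omega
    simp only [h, this, if_false]

variable {Ω : Type*} [MeasurableSpace Ω] {P : Measure Ω}
  {X : Ω → Fin n → ℕ → ℝ}

/-- The left-hand variable reads only lifetimes of index at most `m`, a finite block disjoint from
the lifetimes of index `m + 1`. -/
lemma indepFun_newLifetimes (hΦ : IsSemiCoherent Φ) (hXmeas : ∀ i m, Measurable fun ω => X ω i m)
    (hXindep : iIndepFun (fun (q : Fin n × ℕ) (ω : Ω) => X ω q.1 q.2) P) (m : ℕ) :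
    IndepFun (fun ω => (pastCycles Φ r m (X ω), residual Φ r (X ω) m))
      (fun ω i => X ω i (m + 1)) P := by
  classical
  let S : Finset (Fin n × ℕ) := Finset.univ ×ˢ Finset.range (m + 1)
  let S' : Finset (Fin n × ℕ) := Finset.univ ×ˢ {m + 1}
  have hdisj : Disjoint S S' := by
    rw [Finset.disjoint_left]
    rintro ⟨i, j⟩ h1 h2
    simp only [S, S', Finset.mem_product, Finset.mem_univ, true_and, Finset.mem_range,
      Finset.mem_singleton] at h1 h2
    omega
  have hind := hXindep.indepFun_finset S S' hdisj fun q => hXmeas q.1 q.2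
  -- The filler 0 is harmless: lifetimes outside the block are never read.
  let ext : (S → ℝ) → Fin n → ℕ → ℝ := fun a i j => if h : (i, j) ∈ S then a ⟨(i, j), h⟩ else 0
  have hext : Measurable ext := by
    refine measurable_pi_lambda _ fun i => measurable_pi_lambda _ fun j => ?_
    by_cases h : (i, j) ∈ S
    · simpa only [ext, dif_pos h] using measurable_pi_apply _
    · simpa only [ext, dif_neg h] using measurable_const
  let new : (S' → ℝ) → Fin n → ℝ := fun a i => a ⟨(i, m + 1), by simp [S']⟩
  have hnew : Measurable new := measurable_pi_lambda _ fun i => measurable_pi_apply _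
  have h := hind.comp (((measurable_pastCycles (r := r) hΦ m).prodMk
    (measurable_residual (r := r) hΦ m)).comp hext) hnew
  have hext_eq : ∀ ω, ∀ i, ∀ j ≤ m, ext (fun q : S => X ω q.1.1 q.1.2) i j = X ω i j := by
    intro ω i j hj
    have hm : (i, j) ∈ S := by simpa [S] using Nat.lt_succ_of_le hj
    simp only [ext, dif_pos hm]
  refine h.congr (Eventually.of_forall fun ω => ?_) (Eventually.of_forall fun ω => rfl)
  simp only [Function.comp_apply]
  rw [pastCycles_congr (hext_eq ω), residual_congr (hext_eq ω)]

variable [IsProbabilityMeasure P]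

lemma measurePreserving_newLifetimes (hXmeas : ∀ i m, Measurable fun ω => X ω i m)
    (hXindep : iIndepFun (fun (q : Fin n × ℕ) (ω : Ω) => X ω q.1 q.2) P)
    (hXlaw : ∀ i m, P.map (fun ω => X ω i m) = expMeasure μ) (m : ℕ) :
    MeasurePreserving (fun ω i => X ω i m) P (lifetimeLaw n μ) := by
  refine ⟨measurable_pi_lambda _ fun i => hXmeas i m, ?_⟩
  have hinj : Function.Injective fun i : Fin n => (i, m) := fun i j h => congrArg Prod.fst h
  have h := (iIndepFun_iff_map_fun_eq_pi_map fun i => (hXmeas i m).aemeasurable).1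
    (hXindep.precomp hinj)
  rw [h]
  simp only [hXlaw]

lemma isProbabilityMeasure_cycleLaw (hΦ : IsSemiCoherent Φ) (hμ : 0 < μ) :
    IsProbabilityMeasure (cycleLaw Φ r μ) := by
  have := isProbabilityMeasure_expMeasure hμ
  exact Measure.isProbabilityMeasure_map (measurable_cycle_pair hΦ).aemeasurable

/-- The residual lifetimes at a repair are distributed like new ones, and independent of the
cycles before this repair. -/
theorem exists_measurePreserving_past_residual (hΦ : IsSemiCoherent Φ) (hμ : 0 < μ)
    (hXmeas : ∀ i m, Measurable fun ω => X ω i m)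
    (hXindep : iIndepFun (fun (q : Fin n × ℕ) (ω : Ω) => X ω q.1 q.2) P)
    (hXlaw : ∀ i m, P.map (fun ω => X ω i m) = expMeasure μ) (m : ℕ) :
    ∃ H : Measure (ℕ → ℝ × (Fin n → Bool)), IsProbabilityMeasure H ∧
      MeasurePreserving (fun ω => (pastCycles Φ r m (X ω), residual Φ r (X ω) m)) P
        (H.prod (lifetimeLaw n μ)) := by
  have := isProbabilityMeasure_expMeasure hμ
  have := isProbabilityMeasure_cycleLaw (r := r) hΦ hμ
  have hX : Measurable X := measurable_pi_lambda _ fun i => measurable_pi_lambda _ fun m =>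
    hXmeas i m
  induction m with
  | zero =>
    refine ⟨Measure.dirac fun _ => (0, fun _ => true), inferInstance, ?_⟩
    have h0 := measurePreserving_newLifetimes hXmeas hXindep hXlaw 0
    refine ⟨((measurable_pastCycles hΦ 0).comp hX).prodMk h0.measurable, ?_⟩
    have hp : ∀ ω, pastCycles Φ r 0 (X ω) = fun _ => (0, fun _ => true) := fun ω => by
      funext j
      simp [pastCycles]
    simp only [hp]
    rw [Measure.dirac_prod, ← h0.map_eq, Measure.map_map measurable_prodMk_left h0.measurable]
    rfl
  | succ m ih =>
    obtain ⟨H, hH, hmp⟩ := ih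
    have hnew := measurePreserving_newLifetimes hXmeas hXindep hXlaw (m + 1)
    have hind := indepFun_newLifetimes (r := r) hΦ hXmeas hXindep m
    -- Past, residual lifetimes and new lifetimes are independent. The renewal property turns the
    -- last two into a cycle and fresh residual lifetimes independent of it; the cycle is then
    -- written into the past at position `m`.
    have h1 : MeasurePreserving (fun ω => ((pastCycles Φ r m (X ω), residual Φ r (X ω) m),
        fun i => X ω i (m + 1))) P ((H.prod (lifetimeLaw n μ)).prod (lifetimeLaw n μ)) := by
      refine ⟨hmp.measurable.prodMk hnew.measurable, ?_⟩
      rw [(indepFun_iff_map_prod_eq_prod_map_map hmp.aemeasurable hnew.aemeasurable).1 hind,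
        hmp.map_eq, hnew.map_eq]
    have hF : MeasurePreserving (fun p : (Fin n → ℝ) × (Fin n → ℝ) =>
        ((cycleLength Φ r p.1, cycleState Φ r p.1), renew Φ r p.1 p.2))
        ((lifetimeLaw n μ).prod (lifetimeLaw n μ)) ((cycleLaw Φ r μ).prod (lifetimeLaw n μ)) :=
      ⟨((measurable_cycle_pair hΦ).comp measurable_fst).prodMk (measurable_renew hΦ),
        map_cycle_renew hΦ hμ⟩
    have hupd : Measurable fun q : (ℕ → ℝ × (Fin n → Bool)) × (ℝ × (Fin n → Bool)) =>
        Function.update q.1 m q.2 := measurable_update'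
    refine ⟨(H.prod (cycleLaw Φ r μ)).map fun q => Function.update q.1 m q.2,
      Measure.isProbabilityMeasure_map hupd.aemeasurable, ?_⟩
    have h2 := (measurePreserving_prodAssoc H (lifetimeLaw n μ) (lifetimeLaw n μ)).comp h1
    have h3 := ((MeasurePreserving.id H).prod hF).comp h2
    have h4 := ((measurePreserving_prodAssoc H (cycleLaw Φ r μ) (lifetimeLaw n μ)).symm
      MeasurableEquiv.prodAssoc).comp h3
    have h5 := ((hupd.measurePreserving (H.prod (cycleLaw Φ r μ))).prod
      (MeasurePreserving.id (lifetimeLaw n μ))).comp h4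
    convert h5 using 1
    funext ω
    rw [pastCycles_succ]
    rfl

theorem measurePreserving_residual (hΦ : IsSemiCoherent Φ) (hμ : 0 < μ)
    (hXmeas : ∀ i m, Measurable fun ω => X ω i m)
    (hXindep : iIndepFun (fun (q : Fin n × ℕ) (ω : Ω) => X ω q.1 q.2) P)
    (hXlaw : ∀ i m, P.map (fun ω => X ω i m) = expMeasure μ) (m : ℕ) :
    MeasurePreserving (fun ω => residual Φ r (X ω) m) P (lifetimeLaw n μ) := by
  have := isProbabilityMeasure_expMeasure hμ
  obtain ⟨H, hH, hmp⟩ :=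
    exists_measurePreserving_past_residual (r := r) hΦ hμ hXmeas hXindep hXlaw m
  exact measurePreserving_snd.comp hmp

lemma measurePreserving_cycle (hΦ : IsSemiCoherent Φ) (hμ : 0 < μ)
    (hXmeas : ∀ i m, Measurable fun ω => X ω i m)
    (hXindep : iIndepFun (fun (q : Fin n × ℕ) (ω : Ω) => X ω q.1 q.2) P)
    (hXlaw : ∀ i m, P.map (fun ω => X ω i m) = expMeasure μ) (m : ℕ) :
    MeasurePreserving (fun ω => cycle Φ r m (X ω)) P (cycleLaw Φ r μ) :=
  ((measurable_cycle_pair hΦ).measurePreserving _).comp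
    (measurePreserving_residual hΦ hμ hXmeas hXindep hXlaw m)

theorem indepFun_pastCycles_cycle (hΦ : IsSemiCoherent Φ) (hμ : 0 < μ)
    (hXmeas : ∀ i m, Measurable fun ω => X ω i m)
    (hXindep : iIndepFun (fun (q : Fin n × ℕ) (ω : Ω) => X ω q.1 q.2) P)
    (hXlaw : ∀ i m, P.map (fun ω => X ω i m) = expMeasure μ) (m : ℕ) :
    IndepFun (fun ω j => if j < m then cycle Φ r j (X ω) else (0, fun _ => true))
      (fun ω => cycle Φ r m (X ω)) P := by
  have := isProbabilityMeasure_expMeasure hμ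
  obtain ⟨H, hH, hmp⟩ :=
    exists_measurePreserving_past_residual (r := r) hΦ hμ hXmeas hXindep hXlaw m
  have h1 : MeasurePreserving (fun ω => pastCycles Φ r m (X ω)) P H := measurePreserving_fst.comp hmp
  have h2 : MeasurePreserving (fun ω => residual Φ r (X ω) m) P (lifetimeLaw n μ) :=
    measurePreserving_snd.comp hmp
  have hind : IndepFun (fun ω => pastCycles Φ r m (X ω)) (fun ω => residual Φ r (X ω) m) P := by
    rw [indepFun_iff_map_prod_eq_prod_map_map h1.aemeasurable h2.aemeasurable, hmp.map_eq,
      h1.map_eq, h2.map_eq]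
  exact hind.comp measurable_id (measurable_cycle_pair hΦ)

/-- Pairwise independence is all that the strong law requires. -/
lemma pairwise_indepFun_cycle (hΦ : IsSemiCoherent Φ) (hμ : 0 < μ)
    (hXmeas : ∀ i m, Measurable fun ω => X ω i m)
    (hXindep : iIndepFun (fun (q : Fin n × ℕ) (ω : Ω) => X ω q.1 q.2) P)
    (hXlaw : ∀ i m, P.map (fun ω => X ω i m) = expMeasure μ) {g : ℝ × (Fin n → Bool) → ℝ} (hg : Measurable g) :
    Pairwise (Function.onFun (fun f f' => IndepFun f f' P)
      fun m ω => g (cycle Φ r m (X ω))) := by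
  have h : ∀ i j, i < j → IndepFun (fun ω => g (cycle Φ r i (X ω)))
      (fun ω => g (cycle Φ r j (X ω))) P := by
    intro i j hij
    have := (indepFun_pastCycles_cycle (r := r) hΦ hμ hXmeas hXindep hXlaw j).comp
      (hg.comp (measurable_pi_apply i)) hg
    simpa only [Function.comp_def, if_pos hij] using this
  intro i j hij
  rcases lt_or_gt_of_ne hij with h1 | h1
  · exact h i j h1
  · exact (h j i h1).symm

/-- The strong law of large numbers for rewards of the cycles. -/
theorem tendsto_sum_cycle_div (hΦ : IsSemiCoherent Φ) (hμ : 0 < μ)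
    (hXmeas : ∀ i m, Measurable fun ω => X ω i m)
    (hXindep : iIndepFun (fun (q : Fin n × ℕ) (ω : Ω) => X ω q.1 q.2) P)
    (hXlaw : ∀ i m, P.map (fun ω => X ω i m) = expMeasure μ) {g : ℝ × (Fin n → Bool) → ℝ} (hg : Measurable g)
    (hgi : Integrable g (cycleLaw Φ r μ)) :
    ∀ᵐ ω ∂P, Tendsto (fun m : ℕ => (∑ j ∈ Finset.range m, g (cycle Φ r j (X ω))) / m) atTop
      (𝓝 (∫ y, g y ∂(cycleLaw Φ r μ))) := by
  have hmp := measurePreserving_cycle (r := r) hΦ hμ hXmeas hXindep hXlaw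
  have h := strong_law_ae_real (μ := P) (fun m ω => g (cycle Φ r m (X ω)))
    ((hmp 0).integrable_comp_of_integrable hgi)
    (pairwise_indepFun_cycle hΦ hμ hXmeas hXindep hXlaw hg)
    (fun m => IdentDistrib.comp ⟨(hmp m).aemeasurable, (hmp 0).aemeasurable,
      by rw [(hmp m).map_eq, (hmp 0).map_eq]⟩ hg)
  have hint : ∫ ω, g (cycle Φ r 0 (X ω)) ∂P = ∫ y, g y ∂(cycleLaw Φ r μ) := by
    rw [← (hmp 0).map_eq, integral_map (hmp 0).aemeasurable hg.aestronglyMeasurable]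
  rwa [hint] at h

end RepairPolicy

/-! ### The first system failure in terms of the cycles -/

namespace RepairPolicy

variable {n : ℕ} {Φ : (Fin n → Bool) → Bool} {r : ℕ} {μ : ℝ} {ℓ : Fin n → ℕ → ℝ}

lemma repairTime_strictMono (hΦ : IsSemiCoherent Φ)
    (hℓ : ∀ m, 0 < cycleLength Φ r (residual Φ r ℓ m)) : StrictMono (repairTime Φ r ℓ) :=
  strictMono_nat_of_lt_succ fun m => by
    rw [repairTime_succ hΦ]
    exact lt_add_of_pos_right _ (hℓ m)

lemma repairTime_succ_pos (hΦ : IsSemiCoherent Φ)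
    (hℓ : ∀ m, 0 < cycleLength Φ r (residual Φ r ℓ m)) (m : ℕ) :
    0 < repairTime Φ r ℓ (m + 1) := by
  have := repairTime_strictMono hΦ hℓ (Nat.succ_pos m)
  rwa [repairTime_zero] at this

lemma ofReal_repairTime_le_iff (hΦ : IsSemiCoherent Φ)
    (hℓ : ∀ m, 0 < cycleLength Φ r (residual Φ r ℓ m)) (m j : ℕ) :
    ENNReal.ofReal (repairTime Φ r ℓ (m + 1)) ≤ ENNReal.ofReal (repairTime Φ r ℓ (j + 1))
      ↔ m ≤ j := by
  rw [ENNReal.ofReal_le_ofReal_iff (repairTime_succ_pos hΦ hℓ j).le,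
    (repairTime_strictMono hΦ hℓ).le_iff_le, Nat.add_le_add_iff_right]

/-- Repair times increase strictly, so comparing times means comparing indices. Stopping at the
first failure thus becomes stopping at the first exit from the working final states. -/
lemma ofReal_repairTime_le_firstFailure_iff (hΦ : IsSemiCoherent Φ)
    (hℓ : ∀ m, 0 < cycleLength Φ r (residual Φ r ℓ m)) (m : ℕ) :
    ENNReal.ofReal (repairTime Φ r ℓ (m + 1)) ≤ firstFailure Φ r ℓ
      ↔ ∀ j < m, Φ (repairState Φ r ℓ j) = true := by
  rw [firstFailure, le_iInf₂_iff]
  simp only [ofReal_repairTime_le_iff hΦ hℓ]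
  refine forall_congr' fun j => ?_
  rw [← not_lt, ← Bool.not_eq_true, not_imp_not]

lemma ofReal_firstRepair_eq_firstFailure_iff (hΦ : IsSemiCoherent Φ)
    (hℓ : ∀ m, 0 < cycleLength Φ r (residual Φ r ℓ m)) :
    ENNReal.ofReal (firstRepair Φ r ℓ) = firstFailure Φ r ℓ
      ↔ Φ (repairState Φ r ℓ 0) = false := by
  constructor
  · intro h
    by_contra h0
    have h1 : ENNReal.ofReal (repairTime Φ r ℓ (1 + 1)) ≤ firstFailure Φ r ℓ := by
      rw [ofReal_repairTime_le_firstFailure_iff hΦ hℓ]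
      intro j hj
      rw [Nat.lt_one_iff.1 hj]
      simpa using h0
    rw [← h, firstRepair, ofReal_repairTime_le_iff hΦ hℓ 1 0] at h1
    omega
  · intro h
    exact le_antisymm ((ofReal_repairTime_le_firstFailure_iff hΦ hℓ 0).2 (by simp))
      (iInf₂_le 0 h)

lemma totalCost_firstRepair (hΦ : IsSemiCoherent Φ)
    (hℓ : ∀ m, 0 < cycleLength Φ r (residual Φ r ℓ m)) (csys : ℝ) (ccmp : ℕ → ℝ) :
    totalCost Φ r csys ccmp ℓ (ENNReal.ofReal (firstRepair Φ r ℓ))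
      = repairCost Φ csys ccmp (repairState Φ r ℓ 0) := by
  rw [totalCost, tsum_eq_single 0]
  · exact if_pos le_rfl
  · intro m hm
    refine if_neg fun h => hm ?_
    rw [firstRepair, ofReal_repairTime_le_iff hΦ hℓ m 0] at h
    omega

lemma totalCost_firstFailure (hΦ : IsSemiCoherent Φ)
    (hℓ : ∀ m, 0 < cycleLength Φ r (residual Φ r ℓ m)) (csys : ℝ) (ccmp : ℕ → ℝ) :
    totalCost Φ r csys ccmp ℓ (firstFailure Φ r ℓ)
      = ∑' m, if ∀ j < m, Φ (repairState Φ r ℓ j) = true then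
          repairCost Φ csys ccmp (repairState Φ r ℓ m) else 0 := by
  simp only [totalCost, ofReal_repairTime_le_firstFailure_iff hΦ hℓ]

lemma firstFailure_eq (hΦ : IsSemiCoherent Φ)
    (hℓ : ∀ m, 0 < cycleLength Φ r (residual Φ r ℓ m)) {m : ℕ}
    (hm : Φ (repairState Φ r ℓ m) = false) (hlt : ∀ j < m, Φ (repairState Φ r ℓ j) = true) :
    firstFailure Φ r ℓ = ENNReal.ofReal (repairTime Φ r ℓ (m + 1)) :=
  le_antisymm (iInf₂_le m hm) ((ofReal_repairTime_le_firstFailure_iff hΦ hℓ m).2 hlt)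

lemma exists_first_failed (h : ∃ m, Φ (repairState Φ r ℓ m) = false) :
    ∃ m, Φ (repairState Φ r ℓ m) = false ∧ ∀ j < m, Φ (repairState Φ r ℓ j) = true := by
  classical
  exact ⟨Nat.find h, Nat.find_spec h, fun j hj => by simpa using Nat.find_min h hj⟩

/-- The sum runs over the cycles up to and including the first that ends in failure. The last
hypothesis excludes the value `∞`, whose `toReal` is 0. -/
lemma toReal_firstFailure (hΦ : IsSemiCoherent Φ)
    (hℓ : ∀ m, 0 < cycleLength Φ r (residual Φ r ℓ m))
    (h : ∃ m, Φ (repairState Φ r ℓ m) = false) :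
    (firstFailure Φ r ℓ).toReal
      = ∑' m, if ∀ j < m, Φ (repairState Φ r ℓ j) = true then
          cycleLength Φ r (residual Φ r ℓ m) else 0 := by
  obtain ⟨m, hm, hlt⟩ := exists_first_failed h
  rw [firstFailure_eq hΦ hℓ hm hlt, ENNReal.toReal_ofReal (repairTime_succ_pos hΦ hℓ m).le,
    repairTime_eq_sum hΦ, tsum_eq_sum (s := Finset.range (m + 1))]
  · refine Finset.sum_congr rfl fun j hj => ?_
    rw [if_pos fun i hi => hlt i (by have := Finset.mem_range.1 hj; omega)]
  · intro j hj
    refine if_neg fun h => ?_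
    have := h m (by simpa using hj)
    rw [hm] at this
    exact absurd this (by simp)

lemma ae_cycleLength_pos {Ω : Type*} [MeasurableSpace Ω] {P : Measure Ω} [IsProbabilityMeasure P]
    {X : Ω → Fin n → ℕ → ℝ} (hΦ : IsSemiCoherent Φ) (hμ : 0 < μ) (hr1 : 1 ≤ r)
    (hXmeas : ∀ i m, Measurable fun ω => X ω i m)
    (hXindep : iIndepFun (fun (q : Fin n × ℕ) (ω : Ω) => X ω q.1 q.2) P)
    (hXlaw : ∀ i m, P.map (fun ω => X ω i m) = expMeasure μ) :
    ∀ᵐ ω ∂P, ∀ m, 0 < cycleLength Φ r (residual Φ r (X ω) m) := by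
  refine ae_all_iff.2 fun m => ?_
  have h := (measurePreserving_residual (r := r) hΦ hμ hXmeas hXindep hXlaw
    m).quasiMeasurePreserving.ae (ae_lifetimeLaw_pos hμ)
  filter_upwards [h] with ω hω
  exact cycleLength_pos hΦ hr1 hω

end RepairPolicy

/-! ### Assembly of the three claims -/

theorem corollary1
    {Ω : Type*} [MeasurableSpace Ω] (P : Measure Ω) [IsProbabilityMeasure P]
    (n : ℕ) (hn : 1 < n)
    (Φ : (Fin n → Bool) → Bool) (hΦ : IsSemiCoherent Φ)
    (r : ℕ) (hr1 : 1 ≤ r) (hrn : r ≤ n)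
    (csys : ℝ) (ccmp : ℕ → ℝ)
    (μ : ℝ) (hμ : 0 < μ)
    -- the i.i.d. exponential lifetimes of the components, initial and after each repair
    (X : Ω → Fin n → ℕ → ℝ)
    (hXmeas : ∀ i m, Measurable fun ω => X ω i m)
    (hXindep : iIndepFun (fun (q : Fin n × ℕ) (ω : Ω) => X ω q.1 q.2) P)
    (hXlaw : ∀ i m, P.map (fun ω => X ω i m) = expMeasure μ) :
    -- probability that the first repair is due to a system failure
    P.real {ω | ENNReal.ofReal (firstRepair Φ r (X ω)) = firstFailure Φ r (X ω)}
        = ∑ k ∈ Finset.Icc 1 r, signature Φ k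
    -- expected cost until the first repair
    ∧ Integrable (fun ω =>
        totalCost Φ r csys ccmp (X ω) (ENNReal.ofReal (firstRepair Φ r (X ω)))) P
    ∧ ∫ ω, totalCost Φ r csys ccmp (X ω) (ENNReal.ofReal (firstRepair Φ r (X ω))) ∂P
        = ∑ k ∈ Finset.Icc 1 r, signature Φ k * (csys + ccmp k)
          + (∑ k ∈ Finset.Icc (r + 1) n, signature Φ k) * ccmp r
    -- expected time until the first repair
    ∧ Integrable (fun ω => firstRepair Φ r (X ω)) P
    ∧ ∫ ω, firstRepair Φ r (X ω) ∂P
        = (1 / μ) *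
          (∑ k ∈ Finset.Icc 1 r, signature Φ k * ∑ i ∈ Finset.Icc (n - k + 1) n, 1 / (i : ℝ)
          + (∑ k ∈ Finset.Icc (r + 1) n, signature Φ k)
            * ∑ i ∈ Finset.Icc (n - r + 1) n, 1 / (i : ℝ))
    -- expected cost and time until the first system failure
    ∧ (0 < P.real {ω | ENNReal.ofReal (firstRepair Φ r (X ω)) = firstFailure Φ r (X ω)} →
        (∀ᵐ ω ∂P, firstFailure Φ r (X ω) < ∞)
        ∧ Integrable (fun ω => totalCost Φ r csys ccmp (X ω) (firstFailure Φ r (X ω))) P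
        ∧ ∫ ω, totalCost Φ r csys ccmp (X ω) (firstFailure Φ r (X ω)) ∂P
            = (∫ ω, totalCost Φ r csys ccmp (X ω)
                (ENNReal.ofReal (firstRepair Φ r (X ω))) ∂P)
              / P.real {ω | ENNReal.ofReal (firstRepair Φ r (X ω)) = firstFailure Φ r (X ω)}
        ∧ Integrable (fun ω => (firstFailure Φ r (X ω)).toReal) P
        ∧ ∫ ω, (firstFailure Φ r (X ω)).toReal ∂P
            = (∫ ω, firstRepair Φ r (X ω) ∂P)
              / P.real {ω | ENNReal.ofReal (firstRepair Φ r (X ω)) = firstFailure Φ r (X ω)})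
    -- long-term mean cost; almost surely `C[0,t]` is a finite sum for every `t`
    ∧ (∀ᵐ ω ∂P, ∀ t : ℝ, {m : ℕ | repairTime Φ r (X ω) (m + 1) ≤ t}.Finite)
    ∧ ∀ᵐ ω ∂P, Tendsto
        (fun t : ℝ => totalCost Φ r csys ccmp (X ω) (ENNReal.ofReal t) / t) atTop
        (𝓝 (μ *
          ((∑ k ∈ Finset.Icc 1 r, signature Φ k * (csys + ccmp k)
            + (∑ k ∈ Finset.Icc (r + 1) n, signature Φ k) * ccmp r)
          / (∑ k ∈ Finset.Icc 1 r, signature Φ k * ∑ i ∈ Finset.Icc (n - k + 1) n, 1 / (i : ℝ)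
            + (∑ k ∈ Finset.Icc (r + 1) n, signature Φ k)
              * ∑ i ∈ Finset.Icc (n - r + 1) n, 1 / (i : ℝ))))) := by
  have := isProbabilityMeasure_expMeasure hμ
  have hℓ := ae_cycleLength_pos hΦ hμ hr1 hXmeas hXindep hXlaw
  have hmp := measurePreserving_cycle (r := r) hΦ hμ hXmeas hXindep hXlaw
  have hpair := measurable_cycle_pair (r := r) hΦ
  have := isProbabilityMeasure_cycleLaw (r := r) hΦ hμ
  set EC := ∑ k ∈ Finset.Icc 1 r, signature Φ k * (csys + ccmp k)
          + (∑ k ∈ Finset.Icc (r + 1) n, signature Φ k) * ccmp r with hEC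
  set ET := ∑ k ∈ Finset.Icc 1 r, signature Φ k * ∑ i ∈ Finset.Icc (n - k + 1) n, 1 / (i : ℝ)
          + (∑ k ∈ Finset.Icc (r + 1) n, signature Φ k)
            * ∑ i ∈ Finset.Icc (n - r + 1) n, 1 / (i : ℝ) with hET
  -- rewards of a single cycle
  let cost : ℝ × (Fin n → Bool) → ℝ := fun y => repairCost Φ csys ccmp y.2
  have hcost : Measurable cost := 
    (measurable_of_finite (repairCost Φ csys ccmp)).comp measurable_snd
  have hcost_int : Integrable cost (cycleLaw Φ r μ) :=
    (integrable_map_measure hcost.aestronglyMeasurable hpair.aemeasurable).2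
      (integrable_repairCost hΦ hμ csys ccmp)
  have hcost_mean : ∫ y, cost y ∂(cycleLaw Φ r μ) = EC := by
    rw [cycleLaw, integral_map hpair.aemeasurable hcost.aestronglyMeasurable]
    exact integral_repairCost hΦ hμ hr1 hrn csys ccmp
  have hlen_int : Integrable Prod.fst (cycleLaw Φ r μ) :=
    (integrable_map_measure measurable_fst.aestronglyMeasurable hpair.aemeasurable).2
      (integrable_cycleLength hΦ hμ hrn)
  have hlen_mean : ∫ y, y.1 ∂(cycleLaw Φ r μ) = (1 / μ) * ET := by
    rw [cycleLaw, integral_map hpair.aemeasurable measurable_fst.aestronglyMeasurable]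
    exact integral_cycleLength hΦ hμ hrn
  -- An almost surely positive length has positive mean; this forces the repair times to infinity
  -- and keeps the limit's denominator away from 0.
  have hlen_pos : 0 < (1 / μ) * ET := by
    rw [← hlen_mean, cycleLaw, integral_map hpair.aemeasurable measurable_fst.aestronglyMeasurable,
      integral_pos_iff_support_of_nonneg cycleLength_nonneg (integrable_cycleLength hΦ hμ hrn)]
    have h1 : Function.support (cycleLength Φ r) ∈ ae (lifetimeLaw n μ) := by
      filter_upwards [ae_lifetimeLaw_pos hμ] with ρ hρ
      exact (cycleLength_pos hΦ hr1 hρ).ne'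
    rw [(mem_ae_iff_prob_eq_one (measurableSet_support (measurable_cycleLength hΦ))).1 h1]
    exact one_pos
  -- the event that a cycle ends without a system failure
  let A : Set (ℝ × (Fin n → Bool)) := {y | Φ y.2 = true}
  have hA : MeasurableSet A := measurable_snd (MeasurableSet.of_discrete (s := {x | Φ x = true}))
  have hfail : P.real {ω | ENNReal.ofReal (firstRepair Φ r (X ω)) = firstFailure Φ r (X ω)}
      = (cycleLaw Φ r μ).real Aᶜ := by
    have hae : {ω | ENNReal.ofReal (firstRepair Φ r (X ω)) = firstFailure Φ r (X ω)}
        =ᵐ[P] (fun ω => cycle Φ r 0 (X ω)) ⁻¹' Aᶜ := by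
      filter_upwards [hℓ] with ω hω
      refine propext ?_
      refine (ofReal_firstRepair_eq_firstFailure_iff hΦ hω).trans ?_
      rw [repairState_eq hΦ]
      exact (Bool.not_eq_true _).symm.to_iff
    rw [measureReal_congr hae, measureReal_def, (hmp 0).measure_preimage hA.compl.nullMeasurableSet,
      measureReal_def]
  have hfail' : (cycleLaw Φ r μ).real Aᶜ = ∑ k ∈ Finset.Icc 1 r, signature Φ k := by
    rw [← lifetimeLaw_real_systemFailed hΦ hμ hr1 hrn, cycleLaw, measureReal_def,
      Measure.map_apply hpair hA.compl, measureReal_def]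
    congr 2
    ext ρ
    simp [A]
  have hcostRep : (fun ω => totalCost Φ r csys ccmp (X ω) (ENNReal.ofReal (firstRepair Φ r (X ω))))
      =ᵐ[P] fun ω => cost (cycle Φ r 0 (X ω)) := by
    filter_upwards [hℓ] with ω hω
    rw [totalCost_firstRepair hΦ hω, repairState_eq hΦ]
    rfl
  have htimeRep : (fun ω => firstRepair Φ r (X ω)) = fun ω => (cycle Φ r 0 (X ω)).1 := by
    funext ω
    rw [firstRepair, repairTime_succ hΦ, repairTime_zero, zero_add]
    rfl
  have hcostRep_mean : ∫ ω, totalCost Φ r csys ccmp (X ω)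
      (ENNReal.ofReal (firstRepair Φ r (X ω))) ∂P = EC := by
    rw [integral_congr_ae hcostRep, ← hcost_mean, ← (hmp 0).map_eq,
      integral_map (hmp 0).aemeasurable hcost.aestronglyMeasurable]
  have htimeRep_mean : ∫ ω, firstRepair Φ r (X ω) ∂P = (1 / μ) * ET := by
    rw [htimeRep, ← hlen_mean, ← (hmp 0).map_eq,
      integral_map (hmp 0).aemeasurable measurable_fst.aestronglyMeasurable]
  have hlenLLN := tendsto_sum_cycle_div (r := r) hΦ hμ hXmeas hXindep hXlaw measurable_fst hlen_int
  have hcostLLN := tendsto_sum_cycle_div (r := r) hΦ hμ hXmeas hXindep hXlaw hcost hcost_int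
  rw [hlen_mean] at hlenLLN
  rw [hcost_mean] at hcostLLN
  have hTdiv : ∀ᵐ ω ∂P, Tendsto (fun m : ℕ => repairTime Φ r (X ω) m / m) atTop
      (𝓝 ((1 / μ) * ET)) := by
    filter_upwards [hlenLLN] with ω hω
    simp only [repairTime_eq_sum hΦ]
    exact hω
  refine ⟨hfail.trans hfail', ?_, hcostRep_mean, ?_, htimeRep_mean, ?_, ?_, ?_⟩
  · exact (integrable_congr hcostRep).2 ((hmp 0).integrable_comp_of_integrable hcost_int)
  · rw [htimeRep]
    exact (hmp 0).integrable_comp_of_integrable hlen_int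
  · rw [hcostRep_mean, htimeRep_mean, hfail, probReal_compl_eq_one_sub hA]
    intro hp
    have hq : (cycleLaw Φ r μ).real A < 1 := by linarith
    have hY : ∀ m, Measurable fun ω => cycle Φ r m (X ω) := fun m => (hmp m).measurable
    have hlaw : ∀ m, P.map (fun ω => cycle Φ r m (X ω)) = cycleLaw Φ r μ := fun m => (hmp m).map_eq
    have hind := indepFun_pastCycles_cycle (r := r) hΦ hμ hXmeas hXindep hXlaw
    have hex : ∀ᵐ ω ∂P, ∃ m, Φ (repairState Φ r (X ω) m) = false := by
      filter_upwards [ae_exists_notMem hY hlaw hind hA hq] with ω ⟨m, hm⟩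
      refine ⟨m, ?_⟩
      rw [repairState_eq hΦ]
      exact (Bool.not_eq_true _).to_iff.1 hm
    have hterm : ∀ (g : ℝ × (Fin n → Bool) → ℝ) ω m,
        (if ∀ j < m, Φ (repairState Φ r (X ω) j) = true then g (cycle Φ r m (X ω)) else 0)
          = {ω | ∀ j < m, cycle Φ r j (X ω) ∈ A}.indicator (fun _ => (1 : ℝ)) ω
            * g (cycle Φ r m (X ω)) := by
      intro g ω m
      simp only [repairState_eq hΦ]
      by_cases h : ∀ j < m, Φ (cycleState Φ r (residual Φ r (X ω) j)) = true
      · rw [if_pos h, Set.indicator_of_mem (by exact h), one_mul]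
      · rw [if_neg h, Set.indicator_of_notMem (by exact h), zero_mul]
    have hcostFail : (fun ω => totalCost Φ r csys ccmp (X ω) (firstFailure Φ r (X ω))) =ᵐ[P]
        fun ω => ∑' m, {ω | ∀ j < m, cycle Φ r j (X ω) ∈ A}.indicator (fun _ => (1 : ℝ)) ω
          * cost (cycle Φ r m (X ω)) := by
      filter_upwards [hℓ] with ω hω
      rw [totalCost_firstFailure hΦ hω]
      refine tsum_congr fun m => ?_
      rw [← hterm, repairState_eq hΦ _ m]
      rfl
    have htimeFail : (fun ω => (firstFailure Φ r (X ω)).toReal) =ᵐ[P]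
        fun ω => ∑' m, {ω | ∀ j < m, cycle Φ r j (X ω) ∈ A}.indicator (fun _ => (1 : ℝ)) ω
          * (cycle Φ r m (X ω)).1 := by
      filter_upwards [hℓ, hex] with ω hω hω'
      rw [toReal_firstFailure hΦ hω hω']
      exact tsum_congr fun m => hterm Prod.fst ω m
    obtain ⟨hc1, hc2⟩ := integral_tsum_until_exit hY hlaw hind hA hq hcost hcost_int
    obtain ⟨ht1, ht2⟩ := integral_tsum_until_exit hY hlaw hind hA hq measurable_fst hlen_int
    rw [hcost_mean] at hc2
    rw [hlen_mean] at ht2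
    refine ⟨?_, (integrable_congr hcostFail).2 hc1, (integral_congr_ae hcostFail).trans hc2,
      (integrable_congr htimeFail).2 ht1, (integral_congr_ae htimeFail).trans ht2⟩
    filter_upwards [hℓ, hex] with ω hω hω'
    obtain ⟨m, hm, hlt⟩ := exists_first_failed hω'
    rw [firstFailure_eq hΦ hω hm hlt]
    exact ENNReal.ofReal_lt_top
  · filter_upwards [hTdiv] with ω hω
    exact finite_renewals (tendsto_atTop_of_tendsto_div hlen_pos hω)
  · filter_upwards [hTdiv, hcostLLN, hℓ] with ω hT hC hω
    have h := tendsto_reward_div (repairTime_zero _) (repairTime_strictMono hΦ hω).monotone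
      hlen_pos hT hC
    have hlim : μ * (EC / ET) = EC / ((1 / μ) * ET) := by
      field_simp
    rw [hlim]
    refine h.congr' ?_
    -- For `t ≥ 0` the comparison in `ℝ≥0∞` agrees with the one in `ℝ`.
    filter_upwards [eventually_ge_atTop 0] with t ht
    congr 1
    refine tsum_congr fun m => ?_
    simp only [ENNReal.ofReal_le_ofReal_iff ht, repairState_eq hΦ]
    rfl
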